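/- **Setting.** Let $N,M\in\mathbb N$ and consider the MPC problem $$\text{(P)}\qquad \min_{\{x^{k+1},u^k\}}\ \sum_{k=1}^N\Big(\tfrac12\|x^{k+1}-r_x^k\|_Q^2+\tfrac12\|u^k-r_u^k\|_R^2\Big)\quad\text{s.t.}\quad x^{k+1}=Ax^k+Bu^k,\ \ x^{k+1}\in\mathcal X,\ u^k\in\mathcal U\quad(k=1,\dots,N),$$ with given $x^1$, where $\|v\|_Q^2=v^\top Qv$. Assume that (P) is convex ($Q,R$ symmetric positive semidefinite, $\mathcal X,\mathcal U$ convex) and feasible, and that $\mathcal X,\mathcal U$ are closed. The state and input are partitioned, $x=[x_1;\dots;x_M]$, $u=[u_1;\dots;u_M]$, and the partition is admissible: $Q=\operatorname{diag}(Q_i)$, $R=\operatorname{diag}(R_i)$, $\mathcal X=\{x\mid x_i\in\mathcal X_i\ \forall i\}$, $\mathcal U=\{u\mid u_i\in\mathcal U_i\ \forall i\}$. Write $A=[A_{ij}]$, $B=[B_{ij}]$; let $A^{\rm ext},B^{\rm ext}$ be $A,B$ with the diagonal blocks $A_{ii},B_{ii}$ replaced by $0$. Let the columns of $W_i$ be a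 basis of the range of $[\{A_{ij},B_{ij}\}_{j\ne i}]$, $W=\operatorname{diag}(W_1,\dots,W_M)$, and let $[A^{\rm ext}_r,B^{\rm ext}_r,W_r]$ consist of a maximal linearly independent set of rows of $[A^{\rm ext},B^{\rm ext},W]$. For $i=1,\dots,M$ let $y_i$ stack $u_i^k,w_i^k,x_i^{k+1}$, $k=1,\dots,N$, and $y=[y_1;\dots;y_M]$. Let $\tfrac12y_i^\top\mathcal Q_iy_i+q_i^\top y_i+K_i$ be $\sum_k\big(\tfrac12\|x_i^{k+1}-r_{x_i}^k\|_{Q_i}^2+\tfrac12\|u_i^k-r_{u_i}^k\|_{R_i}^2\big)$, let $C_iy_i=c_i$ express $x_i^{k+1}=A_{ii}x_i^k+B_{ii}u_i^k+W_iw_i^k$ for all $k$, let $y_i\in\mathcal Y_i$ express $x_i^{k+1}\in\mathcal X_i$, $u_i^k\in\mathcal U_i$ for all $k$, and let $Dy=d$ express $W_rw^k=A^{\rm ext}_rx^k+B^{\rm ext}_ru^k$ for all $k$. The split problem is $$\text{(S)}\qquad \min_{y,\zeta,\epsilon}\ \sum_{i=1}^M\big(\tfrac12y_i^\top\mathcal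 Q_iy_i+q_i^\top y_i+K_i\big)\quad\text{s.t.}\quad C_iy_i=c_i,\ \ \zeta_i\in\mathcal Y_i\ (\forall i),\ \ D\epsilon=d,\ \ y=\zeta=\epsilon .$$ **Structure-exploiting ADMM**, with parameters $\beta$ and $\rho_1,\dots,\rho_M$, repeats 1. for all $i$: $y_i\leftarrow\arg\min_{y_i}\ \tfrac12y_i^\top\mathcal Q_iy_i+q_i^\top y_i+\tfrac{\rho_i}2\big[\beta\|y_i-\zeta_i-\lambda_{\zeta_i}\|_2^2+(1-\beta)\|y_i-\epsilon_i-\lambda_{\epsilon_i}\|_2^2\big]$ s.t. $C_iy_i=c_i$; 2. for all $i$: $\zeta_i\leftarrow\Pi_{\mathcal Y_i}(y_i-\lambda_{\zeta_i})$ (orthogonal projection); 3. $\epsilon\leftarrow\arg\min_{\epsilon}\ \tfrac12\big\|E_\epsilon^{1/2}(y-\lambda_\epsilon-\epsilon)\big\|_2^2$ s.t. $D\epsilon=d$, where $E_\epsilon=(1-\beta)\operatorname{diag}(\rho_1I,\dots,\rho_MI)$; 4. $\lambda_\zeta\leftarrow\lambda_\zeta-(y-\zeta)$, $\ \lambda_\epsilon\leftarrow\lambda_\epsilon-(y-\epsilon)$.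 **Conventional ADMM**, with parameter $\rho$, is applied to the unpartitioned problem, in which $y$ stacks $u^k,x^{k+1}$, $k=1,\dots,N$, and $\mathcal Q,q,C,c,\mathcal Y$ express the objective (up to a constant), the dynamics and the constraints of (P). It repeats $y\leftarrow\arg\min_y\{\tfrac12y^\top\mathcal Qy+q^\top y+\tfrac\rho2\|y-\zeta-\lambda\|_2^2\mid Cy=c\}$, $\zeta\leftarrow\Pi_{\mathcal Y}(y-\lambda)$, $\lambda\leftarrow\lambda-(y-\zeta)$. **Proposition.** (i) Let $\beta\in(0,1)$ and $\rho_i>0$ for all $i$, and suppose, as is standard for ADMM, that the Lagrangian of (P) has a saddle point, i.e. (P) has a minimizer that admits a Lagrange multiplier for the dynamics: with $$L(x,u,p)=\sum_{k}\big(\tfrac12\|x^{k+1}-r_x^k\|_Q^2+\tfrac12\|u^k-r_u^k\|_R^2\big)+\sum_k (p^k)^\top(Ax^k+Bu^k-x^{k+1}),$$ there are $x^{k+1}\in\mathcal X$, $u^k\in\mathcal U$ ($k=1,\dots,N$) and $p$ such that $L(x,u,p')\le L(x,u,p)\le L(x',u',p)$ for all $p'$ and all $x'^{k+1}\in\mathcal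 X$, $u'^k\in\mathcal U$. Then every iteration of structure-exploiting ADMM is well defined (each iterate has exactly one successor) and, from every initialization, the iterates $(y,\zeta,\epsilon,\lambda_\zeta,\lambda_\epsilon)$ converge to a fixed point $(y^\star,\zeta^\star,\epsilon^\star,\lambda_\zeta^\star,\lambda_\epsilon^\star)$ of the iteration with $y^\star=\zeta^\star=\epsilon^\star$; the triple $(y^\star,\zeta^\star,\epsilon^\star)$ is optimal for (S), and the states and inputs contained in $y^\star$ are optimal for (P). (ii) If $M=\beta=1$ and $\rho_1=\rho$, structure-exploiting ADMM reduces to conventional ADMM: there are no virtual inputs, so that the vectors $y$ of the two algorithms are identified bijectively by reordering their entries, and under this identification the part $(y,\zeta,\lambda_\zeta)$ of every iteration of structure-exploiting ADMM is an iteration of conventional ADMM with $\lambda=\lambda_\zeta$; conversely, for all values of $\epsilon,\lambda_\epsilon$, every iteration of conventional ADMM arises in this way. -/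

import Mathlib

open Filter Topology
open scoped Matrix Kronecker

namespace SEADMM

/-! ### The MPC problem -/

/-- Data of a linear-quadratic MPC problem with horizon `N`, state coordinates `n` and input
coordinates `m`. Time is shifted by one: for `k : Fin N`, `ru k`, `rx k` are the references for the
`k`-th input and for the state that this input leads to. `x1` is the (given) initial state. -/
structure MPCProblem (N : ℕ) (n m : Type) where
  A : Matrix n n ℝ
  B : Matrix n m ℝ
  Q : Matrix n n ℝ
  R : Matrix m m ℝ
  rx : Fin N → n → ℝ
  ru : Fin N → m → ℝ
  X : Set (n → ℝ)
  U : Set (m → ℝ)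
  x1 : n → ℝ

/-- Squared Euclidean norm. -/
def sqNorm {ι : Type} [Fintype ι] (v : ι → ℝ) : ℝ := v ⬝ᵥ v

/-- `p` is an orthogonal (nearest-point) projection of `z` onto `K`. -/
def IsProj {ι : Type} [Fintype ι] (K : Set (ι → ℝ)) (z p : ι → ℝ) : Prop :=
  p ∈ K ∧ IsMinOn (fun q => sqNorm (z - q)) K p

namespace MPCProblem

variable {N : ℕ} {n m : Type} [Fintype n] [Fintype m] [DecidableEq n]

/-- A trajectory: the states `x^{k+1}` and the inputs `u^k`, for the `N` steps of the horizon. -/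
abbrev Traj (N : ℕ) (n m : Type) : Type := (Fin N → n → ℝ) × (Fin N → m → ℝ)

/-- The state `x^k` from which step `k` starts (`x^1` for the first step). -/
def prev (P : MPCProblem N n m) (x : Fin N → n → ℝ) (k : Fin N) : n → ℝ :=
  (Fin.cons P.x1 x : Fin (N + 1) → n → ℝ) k.castSucc

/-- The tracking objective. -/
noncomputable def objective (P : MPCProblem N n m) (z : Traj N n m) : ℝ :=
  ∑ k, ((1 / 2) * ((z.1 k - P.rx k) ⬝ᵥ P.Q *ᵥ (z.1 k - P.rx k))
      + (1 / 2) * ((z.2 k - P.ru k) ⬝ᵥ P.R *ᵥ (z.2 k - P.ru k)))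

/-- The trajectories that satisfy the state and input constraints (not necessarily the
dynamics). -/
def constraintSet (P : MPCProblem N n m) : Set (Traj N n m) :=
  {z | ∀ k, z.1 k ∈ P.X ∧ z.2 k ∈ P.U}

/-- The residual `A x^k + B u^k - x^{k+1}` of the dynamics. -/
def residual (P : MPCProblem N n m) (z : Traj N n m) (k : Fin N) : n → ℝ :=
  P.A *ᵥ P.prev z.1 k + P.B *ᵥ z.2 k - z.1 k

/-- The feasible trajectories. -/
def feasibleSet (P : MPCProblem N n m) : Set (Traj N n m) :=
  {z | (∀ k, z.1 k = P.A *ᵥ P.prev z.1 k + P.B *ᵥ z.2 k) ∧ z ∈ P.constraintSet}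

/-- `z` is a minimizer of the MPC problem. -/
def IsOptimal (P : MPCProblem N n m) (z : Traj N n m) : Prop :=
  z ∈ P.feasibleSet ∧ IsMinOn P.objective P.feasibleSet z

/-- The MPC problem is convex: symmetric positive semidefinite weights, convex sets. -/
structure IsConvex (P : MPCProblem N n m) : Prop where
  Q_psd : P.Q.PosSemidef
  R_psd : P.R.PosSemidef
  X_convex : Convex ℝ P.X
  U_convex : Convex ℝ P.U

/-- The Lagrangian in which the dynamics are dualized. -/
noncomputable def lagrangian (P : MPCProblem N n m) (z : Traj N n m) (p : Fin N → n → ℝ) : ℝ :=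
  P.objective z + ∑ k, p k ⬝ᵥ P.residual z k

/-- The Lagrangian of the MPC problem has a saddle point. -/
def HasSaddlePoint (P : MPCProblem N n m) : Prop :=
  ∃ z ∈ P.constraintSet, ∃ p : Fin N → n → ℝ,
    (∀ p', P.lagrangian z p' ≤ P.lagrangian z p) ∧
    (∀ z' ∈ P.constraintSet, P.lagrangian z p ≤ P.lagrangian z' p)

/-! ### The stacked form of an MPC problem -/

/-- Coordinates of the stacked variable `[u^1; x^2; ...; u^N; x^{N+1}]`. -/
abbrev StackIdx (N : ℕ) (n m : Type) : Type := Fin N × (m ⊕ n)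

/-- `I_N ⊗ diag(R, Q)`. -/
def stackQ (P : MPCProblem N n m) : Matrix (StackIdx N n m) (StackIdx N n m) ℝ :=
  (1 : Matrix (Fin N) (Fin N) ℝ) ⊗ₖ Matrix.fromBlocks P.R 0 0 P.Q

/-- The stacked references. -/
def stackRef (P : MPCProblem N n m) : StackIdx N n m → ℝ :=
  fun j => Sum.elim (P.ru j.1) (P.rx j.1) j.2

/-- Linear term of the stacked objective. -/
def stackLin (P : MPCProblem N n m) : StackIdx N n m → ℝ :=
  -(P.stackQ *ᵥ P.stackRef)

/-- Constant term of the stacked objective. -/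
noncomputable def stackConst (P : MPCProblem N n m) : ℝ :=
  (1 / 2) * (P.stackRef ⬝ᵥ P.stackQ *ᵥ P.stackRef)

/-- The stacked dynamics matrix: block row `k` is `[... A B -I ...]`, where `A` multiplies
`x^k`, `B` multiplies `u^k` and `-I` multiplies `x^{k+1}`. -/
def stackC (P : MPCProblem N n m) : Matrix (Fin N × n) (StackIdx N n m) ℝ :=
  Matrix.of fun r j => match j with
    | (l, Sum.inl b) => if l = r.1 then P.B r.2 b else 0
    | (l, Sum.inr a) => (if (l : ℕ) + 1 = r.1 then P.A r.2 a else 0)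
        + (if l = r.1 then (-1 : Matrix n n ℝ) r.2 a else 0)

/-- Right-hand side of the stacked dynamics. -/
def stackRhs (P : MPCProblem N n m) : Fin N × n → ℝ :=
  fun r => if (r.1 : ℕ) = 0 then -(P.A *ᵥ P.x1) r.2 else 0

/-- The stacked constraint set. -/
def stackY (P : MPCProblem N n m) : Set (StackIdx N n m → ℝ) :=
  {y | ∀ k, (fun b => y (k, Sum.inl b)) ∈ P.U ∧ (fun a => y (k, Sum.inr a)) ∈ P.X}

/-- The stacked quadratic objective, without its constant. -/
noncomputable def stackObj (P : MPCProblem N n m) (y : StackIdx N n m → ℝ) : ℝ :=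
  (1 / 2) * (y ⬝ᵥ P.stackQ *ᵥ y) + P.stackLin ⬝ᵥ y

/-! ### Conventional ADMM -/

/-- Iterate `(y, ζ, λ)` of conventional ADMM. -/
@[ext] structure ConvState (ι : Type) where
  y : ι → ℝ
  ζ : ι → ℝ
  lam : ι → ℝ

/-- One iteration of conventional ADMM for the unpartitioned problem, from `s` to `s'`. -/
structure ConvStep (P : MPCProblem N n m) (ρ : ℝ) (s s' : ConvState (StackIdx N n m)) : Prop where
  y_feas : P.stackC *ᵥ s'.y = P.stackRhs
  y_min : IsMinOn (fun v => P.stackObj v + ρ / 2 * sqNorm (v - s.ζ - s.lam))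
    {v | P.stackC *ᵥ v = P.stackRhs} s'.y
  ζ_proj : IsProj P.stackY (s'.y - s.lam) s'.ζ
  lam_eq : s'.lam = s.lam - (s'.y - s'.ζ)

end MPCProblem

/-! ### Partitions, virtual inputs and virtual subsystems

The partition is given by the dimensions `nx i`, `nu i`; the coordinates of the full state and
input are the pairs (subsystem, local coordinate). -/

section External

variable {M : ℕ} {nx nu : Fin M → ℕ}

/-- The external part of a matrix: the diagonal blocks are replaced by zero. -/
def external (G : Matrix (Σ i, Fin (nx i)) (Σ i, Fin (nu i)) ℝ) :
    Matrix (Σ i, Fin (nx i)) (Σ i, Fin (nu i)) ℝ :=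
  Matrix.of fun r c => if r.1 = c.1 then 0 else G r c

/-- Block row `i` of `[A, B]` without the blocks `A_ii`, `B_ii`. -/
def extBlockRow (A : Matrix (Σ i, Fin (nx i)) (Σ i, Fin (nx i)) ℝ)
    (B : Matrix (Σ i, Fin (nx i)) (Σ i, Fin (nu i)) ℝ) (i : Fin M) :
    Matrix (Fin (nx i))
      ((Σ j : {j : Fin M // j ≠ i}, Fin (nx j)) ⊕ (Σ j : {j : Fin M // j ≠ i}, Fin (nu j))) ℝ :=
  Matrix.fromCols (Matrix.of fun a c => A ⟨i, a⟩ ⟨c.1, c.2⟩)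
    (Matrix.of fun a c => B ⟨i, a⟩ ⟨c.1, c.2⟩)

end External

/-- A decomposition of the MPC problem along the partition `nx`, `nu`: block-diagonal weights and
product constraint sets (admissibility of the partition), a choice of the matrices `W i`, whose
columns are a basis of the range of `extBlockRow A B i`, and a choice of rows of
`[external A, external B, W]` that remain after the removal of linearly dependent rows. -/
structure Decomposition {N M : ℕ} {nx nu : Fin M → ℕ}
    (P : MPCProblem N (Σ i, Fin (nx i)) (Σ i, Fin (nu i))) where
  Q : ∀ i, Matrix (Fin (nx i)) (Fin (nx i)) ℝ
  R : ∀ i, Matrix (Fin (nu i)) (Fin (nu i)) ℝ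
  X : ∀ i, Set (Fin (nx i) → ℝ)
  U : ∀ i, Set (Fin (nu i) → ℝ)
  Q_eq : P.Q = Matrix.blockDiagonal' Q
  R_eq : P.R = Matrix.blockDiagonal' R
  X_eq : P.X = {x | ∀ i, (fun a => x ⟨i, a⟩) ∈ X i}
  U_eq : P.U = {u | ∀ i, (fun b => u ⟨i, b⟩) ∈ U i}
  nw : Fin M → ℕ
  W : ∀ i, Matrix (Fin (nx i)) (Fin (nw i)) ℝ
  W_indep : ∀ i, LinearIndependent ℝ (W i).col
  W_span : ∀ i, Submodule.span ℝ (Set.range (W i).col)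
    = Submodule.span ℝ (Set.range (extBlockRow P.A P.B i).col)
  rows : Finset (Σ i, Fin (nx i))
  rows_indep : LinearIndependent ℝ fun r : rows =>
    (Matrix.fromCols (Matrix.fromCols (external P.A) (external P.B))
      (Matrix.blockDiagonal' W)).row r
  rows_span : Submodule.span ℝ (Set.range fun r : rows =>
      (Matrix.fromCols (Matrix.fromCols (external P.A) (external P.B))
        (Matrix.blockDiagonal' W)).row r)
    = Submodule.span ℝ (Set.range
      (Matrix.fromCols (Matrix.fromCols (external P.A) (external P.B))
        (Matrix.blockDiagonal' W)).row)

/-- The modified projection of `z` onto `{ε | D ε = d}`, with the diagonal weight `E`: the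
minimizer of `‖E^{1/2} (z - ε)‖²`. -/
def IsModProj {ι κ : Type} [Fintype ι] (E : ι → ℝ) (D : Matrix κ ι ℝ) (d : κ → ℝ)
    (z e : ι → ℝ) : Prop :=
  D *ᵥ e = d ∧ IsMinOn (fun v => ∑ j, E j * (z j - v j) ^ 2) {v | D *ᵥ v = d} e

/-- For positive weights, the modified projection is
`E^{-1/2} Π_{D E^{-1/2} η = d} (E^{1/2} z)`. -/
theorem isModProj_iff {ι κ : Type} [Fintype ι] (E : ι → ℝ) (hE : ∀ j, 0 < E j)
    (D : Matrix κ ι ℝ) (d : κ → ℝ) (z e : ι → ℝ) :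
    IsModProj E D d z e ↔
      ∃ η : ι → ℝ, IsProj {η | D *ᵥ (fun j => (√(E j))⁻¹ * η j) = d} (fun j => √(E j) * z j) η ∧
        e = fun j => (√(E j))⁻¹ * η j := by
  have hs : ∀ j, √(E j) ≠ 0 := fun j => (Real.sqrt_pos.2 (hE j)).ne'
  have key : ∀ v : ι → ℝ, sqNorm ((fun j => √(E j) * z j) - v)
      = ∑ j, E j * (z j - (√(E j))⁻¹ * v j) ^ 2 := by
    intro v
    unfold sqNorm dotProduct
    refine Finset.sum_congr rfl fun j _ => ?_
    have h2 : E j = √(E j) ^ 2 := (Real.sq_sqrt (hE j).le).symm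
    conv_rhs => rw [h2]
    rw [Real.sqrt_sq (Real.sqrt_nonneg _), ← mul_pow, mul_sub, mul_inv_cancel_left₀ (hs j),
      Pi.sub_apply, sq]
  constructor
  · rintro ⟨h1, h2⟩
    have he : (fun j => (√(E j))⁻¹ * (√(E j) * e j)) = e := by
      funext j; rw [inv_mul_cancel_left₀ (hs j)]
    refine ⟨fun j => √(E j) * e j, ⟨?_, ?_⟩, he.symm⟩
    · simpa [he] using h1
    · intro η hη
      have := h2 hη
      simp only [Set.mem_ofPred_eq, key] at this ⊢
      simpa [inv_mul_cancel_left₀ (hs _)] using this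
  · rintro ⟨η, ⟨h1, h2⟩, rfl⟩
    refine ⟨h1, fun v hv => ?_⟩
    have hv' : (fun j => (√(E j))⁻¹ * (√(E j) * v j)) = v := by
      funext j; rw [inv_mul_cancel_left₀ (hs j)]
    have h3 : (fun j => √(E j) * v j) ∈ {η | D *ᵥ (fun j => (√(E j))⁻¹ * η j) = d} := by
      simpa [hv'] using hv
    have := h2 h3
    simp only [Set.mem_ofPred_eq, key] at this ⊢
    simpa [inv_mul_cancel_left₀ (hs _)] using this

namespace Decomposition

open MPCProblem

variable {N M : ℕ} {nx nu : Fin M → ℕ} {P : MPCProblem N (Σ i, Fin (nx i)) (Σ i, Fin (nu i))}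

/-- The `i`-th virtual subsystem, with dynamics `x_i⁺ = A_ii x_i + B_ii u_i + W_i w_i`. Its inputs
are `[u_i; w_i]`, where the virtual input `w_i` has neither cost nor constraints. -/
def subsystem (T : Decomposition P) (i : Fin M) :
    MPCProblem N (Fin (nx i)) (Fin (nu i) ⊕ Fin (T.nw i)) where
  A := Matrix.of fun a b => P.A ⟨i, a⟩ ⟨i, b⟩
  B := Matrix.fromCols (Matrix.of fun a b => P.B ⟨i, a⟩ ⟨i, b⟩) (T.W i)
  Q := T.Q i
  R := Matrix.fromBlocks (T.R i) 0 0 0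
  rx := fun k a => P.rx k ⟨i, a⟩
  ru := fun k => Sum.elim (fun b => P.ru k ⟨i, b⟩) 0
  X := T.X i
  U := {v | (fun b => v (Sum.inl b)) ∈ T.U i}
  x1 := fun a => P.x1 ⟨i, a⟩

/-- Coordinates of `y_i`, the stacked variable `[u_i^k; w_i^k; x_i^{k+1}]`, over all `k`. -/
abbrev SubIdx (T : Decomposition P) (i : Fin M) : Type :=
  StackIdx N (Fin (nx i)) (Fin (nu i) ⊕ Fin (T.nw i))

/-- Coordinates of `y = [y_1; ...; y_M]`. -/
abbrev Idx (T : Decomposition P) : Type := Σ i, T.SubIdx i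

/-- The part `y_i` of `y`. -/
def blk (T : Decomposition P) (y : T.Idx → ℝ) (i : Fin M) : T.SubIdx i → ℝ := fun j => y ⟨i, j⟩

/-- The coupling matrix: block row `k` stands for the remaining rows of
`external A x^k + external B u^k - W w^k`. -/
def couplingD (T : Decomposition P) : Matrix (Fin N × T.rows) T.Idx ℝ :=
  Matrix.of fun r c => match c with
    | ⟨i, (l, Sum.inl (Sum.inl b))⟩ => if l = r.1 then external P.B r.2 ⟨i, b⟩ else 0
    | ⟨i, (l, Sum.inl (Sum.inr b))⟩ =>
        if l = r.1 then -(Matrix.blockDiagonal' T.W r.2 ⟨i, b⟩) else 0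
    | ⟨i, (l, Sum.inr a)⟩ => if (l : ℕ) + 1 = r.1 then external P.A r.2 ⟨i, a⟩ else 0

/-- Right-hand side of the coupling constraint. -/
def couplingRhs (T : Decomposition P) : Fin N × T.rows → ℝ :=
  fun r => if (r.1 : ℕ) = 0 then -(external P.A *ᵥ P.x1) r.2 else 0

/-- Objective of the split problem. -/
noncomputable def splitObjective (T : Decomposition P)
    (v : (T.Idx → ℝ) × (T.Idx → ℝ) × (T.Idx → ℝ)) : ℝ :=
  ∑ i, ((T.subsystem i).stackObj (T.blk v.1 i) + (T.subsystem i).stackConst)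

/-- Feasible triples `(y, ζ, ε)` of the split problem. -/
def splitFeasibleSet (T : Decomposition P) :
    Set ((T.Idx → ℝ) × (T.Idx → ℝ) × (T.Idx → ℝ)) :=
  {v | (∀ i, (T.subsystem i).stackC *ᵥ T.blk v.1 i = (T.subsystem i).stackRhs) ∧
    (∀ i, T.blk v.2.1 i ∈ (T.subsystem i).stackY) ∧
    T.couplingD *ᵥ v.2.2 = T.couplingRhs ∧
    v.1 = v.2.1 ∧ v.2.1 = v.2.2}

/-- `(y, ζ, ε)` is a minimizer of the split problem. -/
def IsSplitOptimal (T : Decomposition P)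
    (v : (T.Idx → ℝ) × (T.Idx → ℝ) × (T.Idx → ℝ)) : Prop :=
  v ∈ T.splitFeasibleSet ∧ IsMinOn T.splitObjective T.splitFeasibleSet v

/-- The states and inputs that are stacked in `y`. -/
def traj (T : Decomposition P) (y : T.Idx → ℝ) :
    Traj N (Σ i, Fin (nx i)) (Σ i, Fin (nu i)) :=
  (fun k a => y ⟨a.1, (k, Sum.inr a.2)⟩, fun k b => y ⟨b.1, (k, Sum.inl (Sum.inl b.2))⟩)

/-! ### Structure-exploiting ADMM -/

/-- Iterate `(y, ζ, ε, λ_ζ, λ_ε)` of structure-exploiting ADMM. -/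
@[ext] structure State (T : Decomposition P) where
  y : T.Idx → ℝ
  ζ : T.Idx → ℝ
  ε : T.Idx → ℝ
  lamζ : T.Idx → ℝ
  lamε : T.Idx → ℝ

/-- One iteration of structure-exploiting ADMM, from `s` to `s'`. -/
structure Step (T : Decomposition P) (β : ℝ) (ρ : Fin M → ℝ) (s s' : T.State) : Prop where
  y_feas : ∀ i, (T.subsystem i).stackC *ᵥ T.blk s'.y i = (T.subsystem i).stackRhs
  y_min : ∀ i, IsMinOn (fun v => (T.subsystem i).stackObj v + ρ i / 2 *
      (β * sqNorm (v - T.blk s.ζ i - T.blk s.lamζ i)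
        + (1 - β) * sqNorm (v - T.blk s.ε i - T.blk s.lamε i)))
    {v | (T.subsystem i).stackC *ᵥ v = (T.subsystem i).stackRhs} (T.blk s'.y i)
  ζ_proj : ∀ i, IsProj (T.subsystem i).stackY (T.blk s'.y i - T.blk s.lamζ i) (T.blk s'.ζ i)
  ε_proj : IsModProj (fun j => (1 - β) * ρ j.1) T.couplingD T.couplingRhs (s'.y - s.lamε) s'.ε
  lamζ_eq : s'.lamζ = s.lamζ - (s'.y - s'.ζ)
  lamε_eq : s'.lamε = s.lamε - (s'.y - s'.ε)

/-- The vector `y` without its virtual inputs, ordered as the stacked variable of the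
unpartitioned problem. -/
def unpart (T : Decomposition P) (y : T.Idx → ℝ) :
    StackIdx N (Σ i, Fin (nx i)) (Σ i, Fin (nu i)) → ℝ :=
  fun j => Sum.elim ((T.traj y).2 j.1) ((T.traj y).1 j.1) j.2

/-- The part `(y, ζ, λ_ζ)` of an iterate, in the coordinates of the unpartitioned problem. -/
def State.toConv {T : Decomposition P} (s : T.State) :
    ConvState (StackIdx N (Σ i, Fin (nx i)) (Σ i, Fin (nu i))) where
  y := T.unpart s.y
  ζ := T.unpart s.ζ
  lam := T.unpart s.lamζ

end Decomposition

end SEADMM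

/-!
The split problem is a convex quadratic program with two copies `ζ` and `ε` of the variable `y`.
After summation over the subsystems, structure-exploiting ADMM is ADMM for this consensus problem
(`ConsensusProblem`), with the penalty of each entry of each copy as a weight
(`Decomposition.step_iff`). Both updates minimize strictly convex coercive quadratic functions over
nonempty closed convex sets, so each iterate has exactly one successor; the minimizers are
characterized by variational inequalities (`HasQuadExpansion.isMinOn_iff`).

Convergence rests on the Douglas–Rachford form of ADMM. Let `a` be the point that is projected in
the `z`-update, where `z` stacks the copies. Then `z = Π a` and `z + λ = 2 Π a - a`, and `a` evolves
by `a ↦ Φ (2 Π a - a) - Π a + a`, where `Φ` maps `z + λ` to the copies of the next `y`. Projection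
and `Φ` are firmly nonexpansive for the weighted inner product, hence so is this operator
(`FirmlyNonexpansive.douglasRachford`), and the iterates of a firmly nonexpansive map with a fixed
point converge to a fixed point (`FirmlyNonexpansive.exists_tendsto`). All parts of the ADMM iterate
are continuous functions of `a` (`ConsensusProblem.exists_tendsto`).

The fixed point comes from the saddle point of the MPC problem (`Decomposition.exists_fixedPoint`).
The residual of the full dynamics is the sum of the residuals of the virtual subsystems and of the
coupling constraint (`Decomposition.residual_traj`), so multipliers for the dynamics serve as
multipliers for both constraints; the removal of linearly dependent coupling rows is harmless, as
these rows lie in the span of the others (`Decomposition.exists_coupling_multiplier`). Every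
feasible trajectory can be completed by virtual inputs (`Decomposition.exists_traj_eq`), and
therefore optimality carries over from the split problem to the MPC problem.

With one subsystem the external parts vanish, so there are neither virtual inputs nor coupling rows,
and with `β = 1` the copy `ε` has weight zero: what is left is conventional ADMM, up to an additive
constant in the objective (`Decomposition.step_iff_convStep`).
-/

namespace SEADMM

/-! ### Minimization of quadratic functions over convex sets -/

section Quadratic

variable {ι : Type}

/-- `F` is a convex quadratic function: `F (p + d) = F p + G p d + r d`, where `G p` is homogeneous
of degree one (the derivative of `F` at `p`) and `r ≥ 0` is homogeneous of degree two. -/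
structure HasQuadExpansion (F : (ι → ℝ) → ℝ) (G : (ι → ℝ) → (ι → ℝ) → ℝ)
    (r : (ι → ℝ) → ℝ) : Prop where
  expand : ∀ p d, F (p + d) = F p + G p d + r d
  smul_fst : ∀ p (t : ℝ) d, G p (t • d) = t * G p d
  smul_snd : ∀ (t : ℝ) d, r (t • d) = t ^ 2 * r d
  nonneg : ∀ d, 0 ≤ r d

variable {F : (ι → ℝ) → ℝ} {G : (ι → ℝ) → (ι → ℝ) → ℝ} {r : (ι → ℝ) → ℝ}

theorem HasQuadExpansion.isMinOn_iff (h : HasQuadExpansion F G r) {S : Set (ι → ℝ)}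
    (hS : Convex ℝ S) {p : ι → ℝ} (hp : p ∈ S) :
    IsMinOn F S p ↔ ∀ v ∈ S, 0 ≤ G p (v - p) := by
  rw [_root_.isMinOn_iff]
  constructor
  · intro hmin v hv
    by_contra! hneg
    have hr := h.nonneg (v - p)
    set g := G p (v - p) with hg
    set c := r (v - p) with hc
    -- a step `t` so small that the linear term `t * g` outweighs the quadratic one: `g + t * c < 0`
    set t := -g / (-g + c) with ht
    have hpos : 0 < -g + c := by linarith
    have ht0 : 0 < t := div_pos (by linarith) hpos
    have ht1 : t ≤ 1 := (div_le_one hpos).2 (by linarith)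
    have hmem : p + t • (v - p) ∈ S := hS.add_smul_sub_mem hp hv ⟨ht0.le, ht1⟩
    have h1 := hmin _ hmem
    rw [h.expand, h.smul_fst, h.smul_snd, ← hg, ← hc] at h1
    have h2 : t * (-g + c) = -g := div_mul_cancel₀ _ hpos.ne'
    have h3 : g + t * c = t * g := by linarith
    have h4 : t * g + t ^ 2 * c = t * (t * g) := by
      rw [← congrArg (t * ·) h3]; ring
    have h5 : t * (t * g) < 0 := mul_neg_of_pos_of_neg ht0 (mul_neg_of_pos_of_neg ht0 hneg)
    linarith
  · intro hvi v hv
    have h1 := h.expand p (v - p)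
    rw [add_sub_cancel] at h1
    have := hvi v hv
    have := h.nonneg (v - p)
    linarith

theorem HasQuadExpansion.eq_of_isMinOn (h : HasQuadExpansion F G r) (hr : ∀ d, r d = 0 → d = 0)
    {S : Set (ι → ℝ)} (hS : Convex ℝ S) {p q : ι → ℝ} (hp : p ∈ S) (hq : q ∈ S)
    (hpmin : IsMinOn F S p) (hqmin : IsMinOn F S q) : p = q := by
  have h1 := h.expand p (q - p)
  rw [add_sub_cancel] at h1
  have h2 := (h.isMinOn_iff hS hp).1 hpmin q hq
  have h3 := _root_.isMinOn_iff.1 hqmin p hp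
  have h4 := h.nonneg (q - p)
  exact (sub_eq_zero.1 (hr _ (by linarith))).symm

/-- A continuous function that grows at least quadratically attains its minimum on every nonempty
closed set. -/
theorem exists_isMinOn_of_quadratic_le [Fintype ι] {S : Set (ι → ℝ)} (hS : IsClosed S)
    (hne : S.Nonempty) (hF : Continuous F) {e u h : ι → ℝ} {K : ℝ} (he : ∀ j, 0 < e j)
    (hle : ∀ v, K + h ⬝ᵥ v + 1 / 2 * ∑ j, e j * (v j - u j) ^ 2 ≤ F v) :
    ∃ p ∈ S, IsMinOn F S p := by
  obtain ⟨v₀, hv₀⟩ := hne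
  -- completing the squares: the sublevel set lies in a box centered at `a`
  set a : ι → ℝ := fun j => u j - h j / e j with ha
  set R : ℝ := 2 * (F v₀ - K - ∑ j, (h j * u j - h j ^ 2 / (2 * e j))) with hR
  have hbound : ∀ v, F v ≤ F v₀ → ∀ j, v j ∈ Set.Icc (a j - √(R / e j)) (a j + √(R / e j)) := by
    intro v hv j
    have h1 : h ⬝ᵥ v + 1 / 2 * ∑ j, e j * (v j - u j) ^ 2
        = 1 / 2 * ∑ j, e j * (v j - a j) ^ 2 + ∑ j, (h j * u j - h j ^ 2 / (2 * e j)) := by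
      rw [dotProduct, Finset.mul_sum, Finset.mul_sum, ← Finset.sum_add_distrib,
        ← Finset.sum_add_distrib]
      refine Finset.sum_congr rfl fun j _ => ?_
      have := (he j).ne'
      simp only [ha]
      field_simp
      ring
    have h2 : ∑ j, e j * (v j - a j) ^ 2 ≤ R := by
      have := hle v
      rw [hR]
      linarith
    have h3 : e j * (v j - a j) ^ 2 ≤ R :=
      (Finset.single_le_sum (f := fun j => e j * (v j - a j) ^ 2)
        (fun i _ => mul_nonneg (he i).le (sq_nonneg _)) (Finset.mem_univ j)).trans h2
    have h4 : (v j - a j) ^ 2 ≤ R / e j := by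
      rw [le_div_iff₀ (he j)]; linarith
    have h5 := abs_le.1 (Real.abs_le_sqrt h4)
    constructor <;> linarith [h5.1, h5.2]
  have hcomp : IsCompact (S ∩ {v | F v ≤ F v₀}) := by
    refine (isCompact_univ_pi fun j => isCompact_Icc
      (a := a j - √(R / e j)) (b := a j + √(R / e j))).of_isClosed_subset
      (hS.inter (isClosed_le hF continuous_const)) ?_
    rintro v ⟨-, hv⟩ j -
    exact hbound v hv j
  obtain ⟨p, ⟨hpS, hp⟩, hmin⟩ := hcomp.exists_isMinOn ⟨v₀, hv₀, le_refl (F v₀)⟩ hF.continuousOn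
  refine ⟨p, hpS, _root_.isMinOn_iff.2 fun v hv => ?_⟩
  rcases le_total (F v) (F v₀) with hle' | hle'
  · exact _root_.isMinOn_iff.1 hmin v ⟨hv, hle'⟩
  · exact le_trans hp hle'

/-- The quadratic function with Hessian `H` and linear term `g`. -/
noncomputable def quad [Fintype ι] (H : Matrix ι ι ℝ) (g v : ι → ℝ) : ℝ :=
  1 / 2 * (v ⬝ᵥ H *ᵥ v) + g ⬝ᵥ v

theorem dotProduct_mulVec_comm_of_isSymm [Fintype ι] {H : Matrix ι ι ℝ} (hH : H.IsSymm)
    (v w : ι → ℝ) : v ⬝ᵥ H *ᵥ w = w ⬝ᵥ H *ᵥ v := by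
  rw [Matrix.dotProduct_mulVec, ← Matrix.mulVec_transpose, hH.eq, dotProduct_comm]

theorem hasQuadExpansion_quad [Fintype ι] {H : Matrix ι ι ℝ} (hH : H.IsSymm)
    (hH' : ∀ v, 0 ≤ v ⬝ᵥ H *ᵥ v) (g : ι → ℝ) :
    HasQuadExpansion (quad H g) (fun p d => (H *ᵥ p + g) ⬝ᵥ d) fun d => 1 / 2 * (d ⬝ᵥ H *ᵥ d) where
  expand p d := by
    simp only [quad, Matrix.mulVec_add, dotProduct_add, add_dotProduct]
    rw [dotProduct_mulVec_comm_of_isSymm hH p d, dotProduct_comm (H *ᵥ p) d]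
    ring
  smul_fst p t d := by simp [dotProduct_smul]
  smul_snd t d := by
    simp only [Matrix.mulVec_smul, dotProduct_smul, smul_dotProduct, smul_eq_mul]
    ring
  nonneg d := mul_nonneg (by norm_num) (hH' d)

theorem continuous_quad [Fintype ι] (H : Matrix ι ι ℝ) (g : ι → ℝ) : Continuous (quad H g) := by
  unfold quad Matrix.mulVec dotProduct
  fun_prop

end Quadratic

/-! ### Iteration of firmly nonexpansive maps -/

section FirmlyNonexpansive

variable {κ : Type} [Fintype κ]

/-- The inner product with weights `E`. -/
def wInner (E v w : κ → ℝ) : ℝ := ∑ k, E k * (v k * w k)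

theorem wInner_self_nonneg {E : κ → ℝ} (hE : ∀ k, 0 < E k) (v : κ → ℝ) : 0 ≤ wInner E v v :=
  Finset.sum_nonneg fun k _ => mul_nonneg (hE k).le (mul_self_nonneg _)

theorem sq_le_wInner_div {E : κ → ℝ} (hE : ∀ k, 0 < E k) (v : κ → ℝ) (k : κ) :
    v k ^ 2 ≤ wInner E v v / E k := by
  rw [le_div_iff₀ (hE k), sq, mul_comm]
  exact Finset.single_le_sum (f := fun k => E k * (v k * v k))
    (fun i _ => mul_nonneg (hE i).le (mul_self_nonneg _)) (Finset.mem_univ k)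

theorem eq_zero_of_wInner_self_le {E : κ → ℝ} (hE : ∀ k, 0 < E k) {v : κ → ℝ}
    (h : wInner E v v ≤ 0) : v = 0 := by
  funext k
  have h1 := sq_le_wInner_div hE v k
  have h2 : wInner E v v / E k ≤ 0 := div_nonpos_of_nonpos_of_nonneg h (hE k).le
  exact pow_eq_zero_iff two_ne_zero |>.1 (le_antisymm (h1.trans h2) (sq_nonneg _))

theorem continuous_wInner_self (E : κ → ℝ) : Continuous fun v : κ → ℝ => wInner E v v := by
  unfold wInner
  fun_prop

theorem tendsto_of_wInner_tendsto_zero {E : κ → ℝ} (hE : ∀ k, 0 < E k) {α : Type} {l : Filter α}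
    {f : α → κ → ℝ} {a : κ → ℝ}
    (h : Tendsto (fun t => wInner E (f t - a) (f t - a)) l (𝓝 0)) : Tendsto f l (𝓝 a) := by
  refine tendsto_pi_nhds.2 fun k => ?_
  rw [tendsto_iff_dist_tendsto_zero]
  have h1 : Tendsto (fun t => √(wInner E (f t - a) (f t - a) / E k)) l (𝓝 0) := by
    have := (h.div_const (E k)).sqrt
    simpa using this
  refine squeeze_zero (fun _ => dist_nonneg) (fun t => ?_) h1
  rw [Real.dist_eq]
  exact Real.abs_le_sqrt (sq_le_wInner_div hE (f t - a) k)

/-- `Φ` is firmly nonexpansive for the inner product with weights `E`. -/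
def FirmlyNonexpansive (E : κ → ℝ) (Φ : (κ → ℝ) → κ → ℝ) : Prop :=
  ∀ a b, wInner E (Φ a - Φ b) (Φ a - Φ b) ≤ wInner E (Φ a - Φ b) (a - b)

theorem FirmlyNonexpansive.sq_add_sq_le {E : κ → ℝ} {Φ : (κ → ℝ) → κ → ℝ}
    (h : FirmlyNonexpansive E Φ) (a b : κ → ℝ) :
    wInner E (Φ a - Φ b) (Φ a - Φ b)
      + wInner E ((a - Φ a) - (b - Φ b)) ((a - Φ a) - (b - Φ b)) ≤ wInner E (a - b) (a - b) := by
  have h1 := h a b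
  have h2 : wInner E ((a - Φ a) - (b - Φ b)) ((a - Φ a) - (b - Φ b))
      = wInner E (a - b) (a - b) - 2 * wInner E (Φ a - Φ b) (a - b)
        + wInner E (Φ a - Φ b) (Φ a - Φ b) := by
    simp only [wInner, Finset.mul_sum, ← Finset.sum_sub_distrib, ← Finset.sum_add_distrib,
      Pi.sub_apply]
    exact Finset.sum_congr rfl fun k _ => by ring
  linarith

theorem FirmlyNonexpansive.continuous {E : κ → ℝ} (hE : ∀ k, 0 < E k) {Φ : (κ → ℝ) → κ → ℝ}
    (h : FirmlyNonexpansive E Φ) : Continuous Φ := by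
  refine continuous_iff_continuousAt.2 fun a => tendsto_of_wInner_tendsto_zero hE ?_
  have h1 : Tendsto (fun b => wInner E (b - a) (b - a)) (𝓝 a) (𝓝 0) := by
    have : Continuous fun b => wInner E (b - a) (b - a) :=
      (continuous_wInner_self E).comp (continuous_id.sub continuous_const)
    simpa [wInner] using this.tendsto a
  refine squeeze_zero (fun b => wInner_self_nonneg hE _) (fun b => ?_) h1
  have := h.sq_add_sq_le b a
  have := wInner_self_nonneg hE ((b - Φ b) - (a - Φ a))
  linarith

/-- The Krasnoselskii–Mann theorem: the iterates of a firmly nonexpansive map that has a fixed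
point converge to a fixed point. -/
theorem FirmlyNonexpansive.exists_tendsto {E : κ → ℝ} (hE : ∀ k, 0 < E k) {Φ : (κ → ℝ) → κ → ℝ}
    (h : FirmlyNonexpansive E Φ) {b : κ → ℝ} (hb : Φ b = b) {a : ℕ → κ → ℝ}
    (ha : ∀ t, a (t + 1) = Φ (a t)) : ∃ c, Φ c = c ∧ Tendsto a atTop (𝓝 c) := by
  -- the distance to any fixed point decreases, hence converges
  have hdec : ∀ c, Φ c = c → ∀ t, wInner E (a (t + 1) - c) (a (t + 1) - c)
      + wInner E (a t - a (t + 1)) (a t - a (t + 1)) ≤ wInner E (a t - c) (a t - c) := by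
    intro c hc t
    have := h.sq_add_sq_le (a t) c
    rwa [hc, sub_self c, sub_zero, ← ha] at this
  have hanti : ∀ c, Φ c = c → Antitone fun t => wInner E (a t - c) (a t - c) := fun c hc =>
    antitone_nat_of_succ_le fun t =>
      le_trans (le_add_of_nonneg_right (wInner_self_nonneg hE _)) (hdec c hc t)
  have hlim : ∀ c, Φ c = c → ∃ x, Tendsto (fun t => wInner E (a t - c) (a t - c)) atTop (𝓝 x) :=
    fun c hc => ⟨_, tendsto_atTop_ciInf (hanti c hc)
      ⟨0, by rintro _ ⟨t, rfl⟩; exact wInner_self_nonneg hE _⟩⟩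
  have hbdd : ∀ t, a t ∈ Set.univ.pi fun k =>
      Set.Icc (b k - √(wInner E (a 0 - b) (a 0 - b) / E k))
        (b k + √(wInner E (a 0 - b) (a 0 - b) / E k)) := by
    intro t k _
    have h1 : (a t k - b k) ^ 2 ≤ wInner E (a 0 - b) (a 0 - b) / E k :=
      (sq_le_wInner_div hE (a t - b) k).trans
        (div_le_div_of_nonneg_right (hanti b hb (Nat.zero_le t)) (hE k).le)
    have h2 := abs_le.1 (Real.abs_le_sqrt h1)
    constructor <;> linarith [h2.1, h2.2]
  obtain ⟨c, -, φ, hφ, hc⟩ := (isCompact_univ_pi fun _ => isCompact_Icc).tendsto_subseq hbdd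
  -- consecutive iterates approach each other, so the cluster point `c` is fixed
  have hdiff : Tendsto (fun t => a t - Φ (a t)) atTop (𝓝 0) := by
    obtain ⟨x, hx⟩ := hlim b hb
    refine tendsto_of_wInner_tendsto_zero hE ?_
    have h1 := hx.sub (hx.comp (tendsto_add_atTop_nat 1))
    rw [sub_self] at h1
    refine squeeze_zero (fun t => wInner_self_nonneg hE _) (fun t => ?_) h1
    have := hdec b hb t
    rw [sub_zero, ← ha]
    simp only [Function.comp]
    linarith
  have hfix : Φ c = c := by
    have h1 : Tendsto (fun t => a (φ t) - Φ (a (φ t))) atTop (𝓝 (c - Φ c)) :=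
      hc.sub (((h.continuous hE).tendsto c).comp hc)
    exact (sub_eq_zero.1 (tendsto_nhds_unique h1 (hdiff.comp hφ.tendsto_atTop))).symm
  refine ⟨c, hfix, tendsto_of_wInner_tendsto_zero hE ?_⟩
  obtain ⟨x, hx⟩ := hlim c hfix
  have h1 : Tendsto (fun t => wInner E (a (φ t) - c) (a (φ t) - c)) atTop (𝓝 0) := by
    have h2 := ((continuous_wInner_self E).tendsto (c - c)).comp (hc.sub_const c)
    simpa [wInner, Function.comp_def] using h2
  rwa [tendsto_nhds_unique (hx.comp hφ.tendsto_atTop) h1] at hx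

/-- The Douglas–Rachford operator of two firmly nonexpansive maps is firmly nonexpansive. -/
theorem FirmlyNonexpansive.douglasRachford {E : κ → ℝ} {Φ Ψ : (κ → ℝ) → κ → ℝ}
    (hΦ : FirmlyNonexpansive E Φ) (hΨ : FirmlyNonexpansive E Ψ) :
    FirmlyNonexpansive E fun a => Φ ((2 : ℝ) • Ψ a - a) - Ψ a + a := by
  intro a b
  have h1 := hΦ ((2 : ℝ) • Ψ a - a) ((2 : ℝ) • Ψ b - b)
  have h2 := hΨ a b
  rw [← sub_nonneg] at h1 h2 ⊢
  have h3 := add_nonneg h1 h2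
  refine h3.trans_eq ?_
  simp only [wInner, ← Finset.sum_sub_distrib, ← Finset.sum_add_distrib, Pi.sub_apply,
    Pi.add_apply, Pi.smul_apply, smul_eq_mul]
  exact Finset.sum_congr rfl fun k _ => by ring

end FirmlyNonexpansive

/-! ### ADMM for general-form consensus problems -/

/-- Data of the consensus problem `min ½ yᵀ H y + gᵀ y` subject to `y ∈ S`, `z ∈ K` and
`z k = y (c k)`: the entry `z k` is a copy of the entry `c k` of `y`, and `E k` is the penalty
weight of this copy in ADMM. -/
structure ConsensusProblem (ι κ : Type) where
  H : Matrix ι ι ℝ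
  g : ι → ℝ
  S : Set (ι → ℝ)
  K : Set (κ → ℝ)
  c : κ → ι
  E : κ → ℝ

namespace ConsensusProblem

variable {ι κ : Type} [Fintype ι] [Fintype κ]

/-- A convex consensus problem with closed nonempty sets, at least one copy of each entry, and
positive weights. -/
structure Regular (C : ConsensusProblem ι κ) : Prop where
  H_symm : C.H.IsSymm
  H_nonneg : ∀ v, 0 ≤ v ⬝ᵥ C.H *ᵥ v
  S_convex : Convex ℝ C.S
  S_closed : IsClosed C.S
  S_nonempty : C.S.Nonempty
  K_convex : Convex ℝ C.K
  K_closed : IsClosed C.K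
  K_nonempty : C.K.Nonempty
  c_surj : Function.Surjective C.c
  E_pos : ∀ k, 0 < C.E k

/-- The augmented objective of the `y`-update, where `w` is the sum of copy and multiplier. -/
noncomputable def yObj (C : ConsensusProblem ι κ) (w : κ → ℝ) (v : ι → ℝ) : ℝ :=
  quad C.H C.g v + 1 / 2 * ∑ k, C.E k * (v (C.c k) - w k) ^ 2

/-- The weighted squared distance to `a`. -/
def zObj (C : ConsensusProblem ι κ) (a v : κ → ℝ) : ℝ := ∑ k, C.E k * (a k - v k) ^ 2

/-- One iteration of ADMM, from `(z, l)` to `(y', z', l')`. -/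
structure Step (C : ConsensusProblem ι κ) (z l : κ → ℝ) (y' : ι → ℝ) (z' l' : κ → ℝ) : Prop where
  y_mem : y' ∈ C.S
  y_min : IsMinOn (C.yObj (z + l)) C.S y'
  z_mem : z' ∈ C.K
  z_min : IsMinOn (C.zObj (y' ∘ C.c - l)) C.K z'
  l_eq : l' = l - (y' ∘ C.c - z')

variable {C : ConsensusProblem ι κ}

theorem hasQuadExpansion_yObj (hC : C.Regular) (w : κ → ℝ) :
    HasQuadExpansion (C.yObj w)
      (fun p d => (C.H *ᵥ p + C.g) ⬝ᵥ d + wInner C.E (p ∘ C.c - w) (d ∘ C.c))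
      fun d => 1 / 2 * (d ⬝ᵥ C.H *ᵥ d) + 1 / 2 * wInner C.E (d ∘ C.c) (d ∘ C.c) := by
  have h := hasQuadExpansion_quad hC.H_symm hC.H_nonneg C.g
  refine ⟨fun p d => ?_, fun p t d => ?_, fun t d => ?_, fun d => ?_⟩
  · have h1 : ∑ k, C.E k * ((p + d) (C.c k) - w k) ^ 2 = ∑ k, C.E k * (p (C.c k) - w k) ^ 2
        + 2 * wInner C.E (p ∘ C.c - w) (d ∘ C.c) + wInner C.E (d ∘ C.c) (d ∘ C.c) := by
      simp only [wInner, Finset.mul_sum, ← Finset.sum_add_distrib]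
      exact Finset.sum_congr rfl fun k _ => by
        simp only [Pi.add_apply, Pi.sub_apply, Function.comp]; ring
    simp only [yObj, h.expand, h1]
    ring
  · have h1 : wInner C.E (p ∘ C.c - w) ((t • d) ∘ C.c)
        = t * wInner C.E (p ∘ C.c - w) (d ∘ C.c) := by
      simp only [wInner, Finset.mul_sum]
      exact Finset.sum_congr rfl fun k _ => by
        simp only [Pi.smul_apply, smul_eq_mul, Function.comp]; ring
    rw [h.smul_fst, h1]; ring
  · have h1 : wInner C.E ((t • d) ∘ C.c) ((t • d) ∘ C.c)
        = t ^ 2 * wInner C.E (d ∘ C.c) (d ∘ C.c) := by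
      simp only [wInner, Finset.mul_sum]
      exact Finset.sum_congr rfl fun k _ => by
        simp only [Pi.smul_apply, smul_eq_mul, Function.comp]; ring
    rw [h.smul_snd, h1]; ring
  · exact add_nonneg (h.nonneg d) (mul_nonneg (by norm_num) (wInner_self_nonneg hC.E_pos _))

theorem hasQuadExpansion_zObj (hC : C.Regular) (a : κ → ℝ) :
    HasQuadExpansion (C.zObj a) (fun p d => 2 * wInner C.E (p - a) d) fun d => wInner C.E d d := by
  refine ⟨fun p d => ?_, fun p t d => ?_, fun t d => ?_, fun d => wInner_self_nonneg hC.E_pos d⟩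
  all_goals
    simp only [zObj, wInner, Finset.mul_sum, ← Finset.sum_add_distrib]
    exact Finset.sum_congr rfl fun k _ => by
      simp only [Pi.add_apply, Pi.sub_apply, Pi.smul_apply, smul_eq_mul]; ring

theorem yObj_isMinOn_iff (hC : C.Regular) {w : κ → ℝ} {y : ι → ℝ} (hy : y ∈ C.S) :
    IsMinOn (C.yObj w) C.S y ↔ ∀ v ∈ C.S,
      0 ≤ (C.H *ᵥ y + C.g) ⬝ᵥ (v - y) + wInner C.E (y ∘ C.c - w) ((v - y) ∘ C.c) :=
  (hasQuadExpansion_yObj hC w).isMinOn_iff hC.S_convex hy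

theorem zObj_isMinOn_iff (hC : C.Regular) {a z : κ → ℝ} (hz : z ∈ C.K) :
    IsMinOn (C.zObj a) C.K z ↔ ∀ v ∈ C.K, 0 ≤ wInner C.E (z - a) (v - z) := by
  rw [(hasQuadExpansion_zObj hC a).isMinOn_iff hC.K_convex hz]
  exact forall₂_congr fun v _ => mul_nonneg_iff_of_pos_left two_pos

theorem existsUnique_yObj_isMinOn (hC : C.Regular) (w : κ → ℝ) :
    ∃! y, y ∈ C.S ∧ IsMinOn (C.yObj w) C.S y := by
  -- the penalties of one copy `σ j` per entry `j` make the objective coercive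
  set σ := Function.surjInv hC.c_surj with hσ
  have hcσ : ∀ j, C.c (σ j) = j := Function.surjInv_eq hC.c_surj
  have hcont : Continuous (C.yObj w) := by
    unfold yObj
    have := continuous_quad C.H C.g
    fun_prop
  obtain ⟨y, hy, hmin⟩ := exists_isMinOn_of_quadratic_le (e := C.E ∘ σ) (u := w ∘ σ) (h := C.g)
    (K := 0) hC.S_closed hC.S_nonempty hcont (fun j => hC.E_pos _) fun v => by
      have h1 : ∑ j, (C.E ∘ σ) j * (v j - (w ∘ σ) j) ^ 2
          ≤ ∑ k, C.E k * (v (C.c k) - w k) ^ 2 := by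
        calc ∑ j, (C.E ∘ σ) j * (v j - (w ∘ σ) j) ^ 2
            = ∑ k ∈ Finset.univ.map ⟨σ, Function.injective_surjInv hC.c_surj⟩,
              C.E k * (v (C.c k) - w k) ^ 2 := by simp [hcσ]
          _ ≤ _ := Finset.sum_le_univ_sum_of_nonneg fun k =>
              mul_nonneg (hC.E_pos k).le (sq_nonneg _)
      have h2 := hC.H_nonneg v
      simp only [yObj, quad]
      linarith
  refine ⟨y, ⟨hy, hmin⟩, fun y' ⟨hy', hmin'⟩ =>
    (hasQuadExpansion_yObj hC w).eq_of_isMinOn (fun d hd => ?_) hC.S_convex hy' hy hmin' hmin⟩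
  have h1 := hC.H_nonneg d
  have h2 : d ∘ C.c = 0 := eq_zero_of_wInner_self_le hC.E_pos (by linarith)
  funext j
  simpa [hcσ] using congrFun h2 (σ j)

theorem existsUnique_zObj_isMinOn (hC : C.Regular) (a : κ → ℝ) :
    ∃! z, z ∈ C.K ∧ IsMinOn (C.zObj a) C.K z := by
  have hcont : Continuous (C.zObj a) := by
    unfold zObj
    fun_prop
  obtain ⟨z, hz, hmin⟩ := exists_isMinOn_of_quadratic_le (e := C.E) (u := a) (h := 0)
    (K := 0) hC.K_closed hC.K_nonempty hcont hC.E_pos fun v => by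
      have h1 : C.zObj a v = ∑ k, C.E k * (v k - a k) ^ 2 :=
        Finset.sum_congr rfl fun k _ => by ring
      have h2 : 0 ≤ C.zObj a v :=
        Finset.sum_nonneg fun k _ => mul_nonneg (hC.E_pos k).le (sq_nonneg _)
      rw [zero_dotProduct, ← h1]
      linarith
  exact ⟨z, ⟨hz, hmin⟩, fun z' ⟨hz', hmin'⟩ =>
    (hasQuadExpansion_zObj hC a).eq_of_isMinOn
      (fun d hd => eq_zero_of_wInner_self_le hC.E_pos hd.le) hC.K_convex hz' hz hmin' hmin⟩

theorem exists_step (hC : C.Regular) (z l : κ → ℝ) : ∃ y' z' l', C.Step z l y' z' l' := by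
  obtain ⟨y', hy', -⟩ := existsUnique_yObj_isMinOn hC (z + l)
  obtain ⟨z', hz', -⟩ := existsUnique_zObj_isMinOn hC (y' ∘ C.c - l)
  exact ⟨y', z', _, hy'.1, hy'.2, hz'.1, hz'.2, rfl⟩

theorem Step.unique (hC : C.Regular) {z l : κ → ℝ} {y₁ y₂ : ι → ℝ} {z₁ z₂ l₁ l₂ : κ → ℝ}
    (h₁ : C.Step z l y₁ z₁ l₁) (h₂ : C.Step z l y₂ z₂ l₂) : y₁ = y₂ ∧ z₁ = z₂ ∧ l₁ = l₂ := by
  obtain rfl := (existsUnique_yObj_isMinOn hC (z + l)).unique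
    ⟨h₁.y_mem, h₁.y_min⟩ ⟨h₂.y_mem, h₂.y_min⟩
  obtain rfl := (existsUnique_zObj_isMinOn hC (y₁ ∘ C.c - l)).unique
    ⟨h₁.z_mem, h₁.z_min⟩ ⟨h₂.z_mem, h₂.z_min⟩
  exact ⟨rfl, rfl, h₁.l_eq.trans h₂.l_eq.symm⟩

/-- The copies of the minimizer in the `y`-update depend on copies and multipliers through a
proximal map, which is firmly nonexpansive. -/
theorem firmlyNonexpansive_of_yObj (hC : C.Regular) {Y : (κ → ℝ) → ι → ℝ}
    (hY : ∀ w, Y w ∈ C.S ∧ IsMinOn (C.yObj w) C.S (Y w)) :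
    FirmlyNonexpansive C.E fun w => Y w ∘ C.c := by
  intro a b
  have h1 := (yObj_isMinOn_iff hC (hY a).1).1 (hY a).2 _ (hY b).1
  have h2 := (yObj_isMinOn_iff hC (hY b).1).1 (hY b).2 _ (hY a).1
  have h3 := hC.H_nonneg (Y a - Y b)
  have h4 : (C.H *ᵥ Y a + C.g) ⬝ᵥ (Y b - Y a) + (C.H *ᵥ Y b + C.g) ⬝ᵥ (Y a - Y b)
      = -((Y a - Y b) ⬝ᵥ C.H *ᵥ (Y a - Y b)) := by
    simp only [Matrix.mulVec_sub, add_dotProduct, dotProduct_sub, sub_dotProduct,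
      dotProduct_comm (Y _) (C.H *ᵥ _)]
    ring
  have h5 : wInner C.E (Y a ∘ C.c - a) ((Y b - Y a) ∘ C.c)
      + wInner C.E (Y b ∘ C.c - b) ((Y a - Y b) ∘ C.c)
      = wInner C.E (Y a ∘ C.c - Y b ∘ C.c) (a - b)
        - wInner C.E (Y a ∘ C.c - Y b ∘ C.c) (Y a ∘ C.c - Y b ∘ C.c) := by
    simp only [wInner, ← Finset.sum_sub_distrib, ← Finset.sum_add_distrib]
    exact Finset.sum_congr rfl fun k _ => by simp only [Pi.sub_apply, Function.comp]; ring
  linarith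

theorem firmlyNonexpansive_of_zObj (hC : C.Regular) {Z : (κ → ℝ) → κ → ℝ}
    (hZ : ∀ a, Z a ∈ C.K ∧ IsMinOn (C.zObj a) C.K (Z a)) : FirmlyNonexpansive C.E Z := by
  intro a b
  have h1 := (zObj_isMinOn_iff hC (hZ a).1).1 (hZ a).2 _ (hZ b).1
  have h2 := (zObj_isMinOn_iff hC (hZ b).1).1 (hZ b).2 _ (hZ a).1
  have h3 : wInner C.E (Z a - a) (Z b - Z a) + wInner C.E (Z b - b) (Z a - Z b)
      = wInner C.E (Z a - Z b) (a - b) - wInner C.E (Z a - Z b) (Z a - Z b) := by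
    simp only [wInner, ← Finset.sum_sub_distrib, ← Finset.sum_add_distrib]
    exact Finset.sum_congr rfl fun k _ => by simp only [Pi.sub_apply]; ring
  linarith

/-- If ADMM has a fixed point, then the iterates converge to a fixed point from every
initialization. -/
theorem exists_tendsto (hC : C.Regular) {y₀ : ι → ℝ} {l₀ : κ → ℝ}
    (h₀ : C.Step (y₀ ∘ C.c) l₀ y₀ (y₀ ∘ C.c) l₀) {y : ℕ → ι → ℝ} {z l : ℕ → κ → ℝ}
    (h : ∀ t, C.Step (z t) (l t) (y (t + 1)) (z (t + 1)) (l (t + 1))) :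
    ∃ (y' : ι → ℝ) (l' : κ → ℝ), C.Step (y' ∘ C.c) l' y' (y' ∘ C.c) l' ∧
      Tendsto y atTop (𝓝 y') ∧ Tendsto z atTop (𝓝 (y' ∘ C.c)) ∧ Tendsto l atTop (𝓝 l') := by
  choose Y hY hYuniq using existsUnique_yObj_isMinOn hC
  choose Z hZ hZuniq using existsUnique_zObj_isMinOn hC
  have hYf := firmlyNonexpansive_of_yObj hC hY
  have hZf := firmlyNonexpansive_of_zObj hC hZ
  have hZcont := hZf.continuous hC.E_pos
  have hYcont : Continuous Y := by
    refine continuous_pi fun j => ?_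
    obtain ⟨k, rfl⟩ := hC.c_surj j
    exact (continuous_apply k).comp (hYf.continuous hC.E_pos)
  -- `a t` is the point that the `z`-update projects; it evolves by the Douglas–Rachford operator
  set a : ℕ → κ → ℝ := fun t => y (t + 1) ∘ C.c - l t with ha
  have hz : ∀ t, z (t + 1) = Z (a t) := fun t => hZuniq _ _ ⟨(h t).z_mem, (h t).z_min⟩
  have hl : ∀ t, l (t + 1) = Z (a t) - a t := fun t => by
    rw [(h t).l_eq, hz t, ← sub_add, sub_add_eq_add_sub, sub_sub_eq_add_sub, add_comm]
  have hy : ∀ t, y (t + 2) = Y ((2 : ℝ) • Z (a t) - a t) := fun t => by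
    have := hYuniq _ _ ⟨(h (t + 1)).y_mem, (h (t + 1)).y_min⟩
    rw [this, hz, hl]
    congr 1
    rw [two_smul]; abel
  have hstep : ∀ t, a (t + 1) = Y ((2 : ℝ) • Z (a t) - a t) ∘ C.c - Z (a t) + a t := fun t => by
    rw [← hy, sub_add, ← hl]
  have hfix : (fun a => Y ((2 : ℝ) • Z a - a) ∘ C.c - Z a + a) (y₀ ∘ C.c - l₀)
      = y₀ ∘ C.c - l₀ := by
    have h1 : Z (y₀ ∘ C.c - l₀) = y₀ ∘ C.c := (hZuniq _ _ ⟨h₀.z_mem, h₀.z_min⟩).symm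
    have h2 : (2 : ℝ) • y₀ ∘ C.c - (y₀ ∘ C.c - l₀) = y₀ ∘ C.c + l₀ := by
      rw [two_smul]; abel
    have h3 : Y (y₀ ∘ C.c + l₀) = y₀ := (hYuniq _ _ ⟨h₀.y_mem, h₀.y_min⟩).symm
    simp only [h1, h2, h3, sub_self, zero_add]
  obtain ⟨b, hb, hab⟩ := (hYf.douglasRachford hZf).exists_tendsto hC.E_pos hfix hstep
  have hb' : Y ((2 : ℝ) • Z b - b) ∘ C.c = Z b := by
    rw [← sub_eq_zero]
    simpa using hb
  have h2 : (2 : ℝ) • Z b - b = Z b + (Z b - b) := by rw [two_smul]; abel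
  have hZab : Tendsto (fun t => Z (a t)) atTop (𝓝 (Z b)) := (hZcont.tendsto b).comp hab
  refine ⟨Y ((2 : ℝ) • Z b - b), Z b - b, ?_, ?_, ?_, ?_⟩
  · rw [hb']
    refine ⟨(hY _).1, ?_, (hZ b).1, ?_, ?_⟩
    · rw [h2]; exact (hY _).2
    · rw [hb', sub_sub_cancel]; exact (hZ b).2
    · rw [hb', sub_self, sub_zero]
  · rw [← tendsto_add_atTop_iff_nat 2]
    simp only [hy]
    exact (hYcont.tendsto _).comp ((hZab.const_smul 2).sub hab)
  · rw [← tendsto_add_atTop_iff_nat 1, hb']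
    simpa only [hz] using hZab
  · rw [← tendsto_add_atTop_iff_nat 1]
    simpa only [hl] using hZab.sub hab

/-- A Karush–Kuhn–Tucker point, in the form of variational inequalities, is a fixed point of
ADMM. -/
theorem step_of_kkt (hC : C.Regular) {y : ι → ℝ} {l : κ → ℝ} (hyS : y ∈ C.S) (hyK : y ∘ C.c ∈ C.K)
    (hS : ∀ v ∈ C.S, 0 ≤ (C.H *ᵥ y + C.g) ⬝ᵥ (v - y) - wInner C.E l ((v - y) ∘ C.c))
    (hK : ∀ v ∈ C.K, 0 ≤ wInner C.E l (v - y ∘ C.c)) :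
    C.Step (y ∘ C.c) l y (y ∘ C.c) l := by
  refine ⟨hyS, (yObj_isMinOn_iff hC hyS).2 fun v hv => ?_, hyK,
    (zObj_isMinOn_iff hC hyK).2 fun v hv => ?_, by rw [sub_self, sub_zero]⟩
  · refine (hS v hv).trans_eq ?_
    rw [sub_eq_add_neg, sub_add_cancel_left]
    simp [wInner]
  · rw [sub_sub_cancel]
    exact hK v hv

/-- A fixed point of ADMM solves the consensus problem. -/
theorem Step.quad_le (hC : C.Regular) {y : ι → ℝ} {l : κ → ℝ}
    (h : C.Step (y ∘ C.c) l y (y ∘ C.c) l) {v : ι → ℝ} (hvS : v ∈ C.S) (hvK : v ∘ C.c ∈ C.K) :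
    quad C.H C.g y ≤ quad C.H C.g v := by
  have h1 := (yObj_isMinOn_iff hC h.y_mem).1 h.y_min v hvS
  have h2 := (zObj_isMinOn_iff hC h.z_mem).1 h.z_min _ hvK
  have h3 : wInner C.E (y ∘ C.c - (y ∘ C.c + l)) ((v - y) ∘ C.c)
      + wInner C.E (y ∘ C.c - (y ∘ C.c - l)) (v ∘ C.c - y ∘ C.c) = 0 := by
    simp only [wInner, ← Finset.sum_add_distrib]
    exact Finset.sum_eq_zero fun k _ => by
      simp only [Pi.sub_apply, Pi.add_apply, Function.comp]; ring
  have h4 := hasQuadExpansion_quad hC.H_symm hC.H_nonneg C.g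
  have h5 := h4.expand y (v - y)
  rw [add_sub_cancel] at h5
  have h6 := h4.nonneg (v - y)
  linarith

end ConsensusProblem

/-! ### The stacked form of an MPC problem -/

namespace MPCProblem

variable {N : ℕ} {n m : Type}

/-- The trajectory that is stacked in `y`. -/
def unstack (y : StackIdx N n m → ℝ) : Traj N n m :=
  (fun k a => y (k, Sum.inr a), fun k b => y (k, Sum.inl b))

theorem prev_of_eq_zero (P : MPCProblem N n m) (x : Fin N → n → ℝ) {k : Fin N}
    (hk : (k : ℕ) = 0) : P.prev x k = P.x1 := by
  have : k.castSucc = 0 := Fin.ext hk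
  simp [prev, this]

theorem prev_of_succ_eq (P : MPCProblem N n m) (x : Fin N → n → ℝ) {k l : Fin N}
    (hk : (l : ℕ) + 1 = k) : P.prev x k = x l := by
  have : k.castSucc = l.succ := Fin.ext hk.symm
  simp [prev, this]

theorem mulVec_prev [Fintype n] {κ : Type} (P : MPCProblem N n m) (G : Matrix κ n ℝ)
    (x : Fin N → n → ℝ) (k : Fin N) (r : κ) :
    (G *ᵥ P.prev x k) r = (if (k : ℕ) = 0 then (G *ᵥ P.x1) r else 0)
      + ∑ l : Fin N, ∑ a, (if (l : ℕ) + 1 = k then G r a else 0) * x l a := by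
  by_cases hk : (k : ℕ) = 0
  · rw [P.prev_of_eq_zero x hk, if_pos hk]
    have : ∀ l : Fin N, (l : ℕ) + 1 ≠ k := fun l => by omega
    simp [this]
  · obtain ⟨l, hl⟩ : ∃ l : Fin N, (l : ℕ) + 1 = k := ⟨⟨k - 1, by omega⟩, by simp; omega⟩
    rw [P.prev_of_succ_eq x hl, if_neg hk, zero_add, Finset.sum_eq_single l]
    · simp [hl, Matrix.mulVec, dotProduct]
    · intro l' _ hne
      have : (l' : ℕ) + 1 ≠ k := fun h => hne (Fin.ext (by omega))
      simp [this]
    · simp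

theorem stackC_mulVec_sub [Fintype n] [Fintype m] [DecidableEq n] (P : MPCProblem N n m)
    (y : StackIdx N n m → ℝ) (k : Fin N) (a : n) :
    (P.stackC *ᵥ y) (k, a) - P.stackRhs (k, a) = P.residual (unstack y) k a := by
  have h1 : (P.stackC *ᵥ y) (k, a)
      = (P.B *ᵥ (unstack y).2 k) a
        + ∑ l : Fin N, ∑ b, (if (l : ℕ) + 1 = k then P.A a b else 0) * (unstack y).1 l b
        - (unstack y).1 k a := by
    simp only [Matrix.mulVec, dotProduct, Fintype.sum_prod_type, Fintype.sum_sum_type, stackC,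
      Matrix.of_apply, Finset.sum_add_distrib, add_mul, unstack]
    simp [ite_mul, Finset.sum_ite_irrel, Matrix.one_apply]
    ring
  rw [h1, residual, Pi.sub_apply, Pi.add_apply, P.mulVec_prev]
  by_cases hk : (k : ℕ) = 0 <;> simp [stackRhs, hk] <;> ring

theorem stackC_mulVec_eq_iff [Fintype n] [Fintype m] [DecidableEq n] (P : MPCProblem N n m)
    (y : StackIdx N n m → ℝ) :
    P.stackC *ᵥ y = P.stackRhs ↔ ∀ k, P.residual (unstack y) k = 0 := by
  simp only [funext_iff, Prod.forall, ← P.stackC_mulVec_sub, Pi.zero_apply, sub_eq_zero]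

theorem dotProduct_stackQ_mulVec [Fintype n] [Fintype m] (P : MPCProblem N n m)
    (y z : StackIdx N n m → ℝ) :
    y ⬝ᵥ P.stackQ *ᵥ z = ∑ k, ((unstack y).1 k ⬝ᵥ P.Q *ᵥ (unstack z).1 k
      + (unstack y).2 k ⬝ᵥ P.R *ᵥ (unstack z).2 k) := by
  have h1 : ∀ k j, (P.stackQ *ᵥ z) (k, j)
      = (Matrix.fromBlocks P.R 0 0 P.Q *ᵥ fun j => z (k, j)) j := by
    intro k j
    simp [Matrix.mulVec, dotProduct, Fintype.sum_prod_type, stackQ, Matrix.one_apply,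
      Finset.sum_ite_irrel]
  simp only [dotProduct, Fintype.sum_prod_type, h1]
  refine Finset.sum_congr rfl fun k _ => ?_
  rw [Fintype.sum_sum_type, add_comm]
  simp [unstack, Matrix.mulVec, dotProduct]

theorem stackQ_isSymm (P : MPCProblem N n m) (hQ : P.Q.IsSymm) (hR : P.R.IsSymm) :
    P.stackQ.IsSymm := by
  unfold stackQ Matrix.IsSymm
  rw [← Matrix.kroneckerMap_transpose, Matrix.transpose_one, Matrix.fromBlocks_transpose, hQ.eq,
    hR.eq, Matrix.transpose_zero, Matrix.transpose_zero]

theorem stackObj_add_stackConst [Fintype n] [Fintype m] (P : MPCProblem N n m)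
    (hQ : P.Q.IsSymm) (hR : P.R.IsSymm) (y : StackIdx N n m → ℝ) :
    P.stackObj y + P.stackConst = P.objective (unstack y) := by
  have hS := P.stackQ_isSymm hQ hR
  have h1 : P.stackObj y + P.stackConst
      = 1 / 2 * ((y - P.stackRef) ⬝ᵥ P.stackQ *ᵥ (y - P.stackRef)) := by
    simp only [stackObj, stackConst, stackLin, Matrix.mulVec_sub, dotProduct_sub, sub_dotProduct,
      neg_dotProduct]
    rw [dotProduct_mulVec_comm_of_isSymm hS P.stackRef y, dotProduct_comm (P.stackQ *ᵥ _) y]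
    ring
  rw [h1, dotProduct_stackQ_mulVec, Finset.mul_sum]
  refine Finset.sum_congr rfl fun k _ => ?_
  rw [mul_add]
  rfl

theorem mem_stackY_iff (P : MPCProblem N n m) (y : StackIdx N n m → ℝ) :
    y ∈ P.stackY ↔ unstack y ∈ P.constraintSet :=
  forall_congr' fun _ => and_comm

end MPCProblem

/-! ### Dynamics, objective and constraints along the partition -/

section Blocks

variable {M : ℕ} {nx nu : Fin M → ℕ}

theorem mulVec_eq_block_add_external (G : Matrix (Σ i, Fin (nx i)) (Σ i, Fin (nu i)) ℝ)
    (v : (Σ i, Fin (nu i)) → ℝ) (i : Fin M) (a : Fin (nx i)) :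
    (G *ᵥ v) ⟨i, a⟩ = (Matrix.of (fun a b => G ⟨i, a⟩ ⟨i, b⟩) *ᵥ fun b => v ⟨i, b⟩) a
      + (external G *ᵥ v) ⟨i, a⟩ := by
  simp only [Matrix.mulVec, dotProduct, Fintype.sum_sigma, Matrix.of_apply, external]
  rw [← Finset.add_sum_erase _ _ (Finset.mem_univ i),
    ← Finset.add_sum_erase _ (fun j => ∑ b, (if i = j then (0 : ℝ) else _) * _)
      (Finset.mem_univ i)]
  simp only [if_true, zero_mul, Finset.sum_const_zero, zero_add]
  congr 1
  refine Finset.sum_congr rfl fun j hj => ?_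
  simp [(Finset.ne_of_mem_erase hj).symm]

theorem blockDiagonal'_mulVec {o : Type} [Fintype o] [DecidableEq o] {α β : o → Type}
    [∀ i, Fintype (β i)] (W : ∀ i, Matrix (α i) (β i) ℝ) (w : (Σ i, β i) → ℝ) (i : o) (a : α i) :
    (Matrix.blockDiagonal' W *ᵥ w) ⟨i, a⟩ = (W i *ᵥ fun b => w ⟨i, b⟩) a := by
  simp only [Matrix.mulVec, dotProduct, Fintype.sum_sigma]
  rw [Finset.sum_eq_single i]
  · simp [Matrix.blockDiagonal'_apply_eq]
  · intro j _ hj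
    simp [Matrix.blockDiagonal'_apply_ne W _ _ hj.symm]
  · simp

theorem dotProduct_blockDiagonal'_mulVec {o : Type} [Fintype o] [DecidableEq o] {α : o → Type}
    [∀ i, Fintype (α i)] (G : ∀ i, Matrix (α i) (α i) ℝ) (v w : (Σ i, α i) → ℝ) :
    v ⬝ᵥ Matrix.blockDiagonal' G *ᵥ w
      = ∑ i, (fun a => v ⟨i, a⟩) ⬝ᵥ G i *ᵥ fun a => w ⟨i, a⟩ := by
  rw [dotProduct, Fintype.sum_sigma]
  simp only [blockDiagonal'_mulVec]
  rfl

theorem dotProduct_fromBlocks_mulVec_inl {α β : Type} [Fintype α] [Fintype β] (R : Matrix α α ℝ)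
    (v w : α ⊕ β → ℝ) : v ⬝ᵥ Matrix.fromBlocks R 0 0 0 *ᵥ w
      = (fun a => v (Sum.inl a)) ⬝ᵥ R *ᵥ fun a => w (Sum.inl a) := by
  rw [Matrix.fromBlocks_mulVec, dotProduct, Fintype.sum_sum_type]
  simp
  rfl

/-- The external parts of `A x` and `B u` lie in the range of the external block row. -/
theorem external_mulVec_mem_span (A : Matrix (Σ i, Fin (nx i)) (Σ i, Fin (nx i)) ℝ)
    (B : Matrix (Σ i, Fin (nx i)) (Σ i, Fin (nu i)) ℝ) (x : (Σ i, Fin (nx i)) → ℝ)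
    (u : (Σ i, Fin (nu i)) → ℝ) (i : Fin M) :
    (fun a => (external A *ᵥ x + external B *ᵥ u) ⟨i, a⟩)
      ∈ Submodule.span ℝ (Set.range (extBlockRow A B i).col) := by
  have hsub : ∀ {μ : Fin M → ℕ} (G : Matrix (Σ i, Fin (nx i)) (Σ i, Fin (μ i)) ℝ)
      (v : (Σ i, Fin (μ i)) → ℝ), (fun a => (external G *ᵥ v) ⟨i, a⟩)
      = ∑ c : Σ i, Fin (μ i), v c • fun a => external G ⟨i, a⟩ c := by
    intro μ G v
    funext a
    simp [Matrix.mulVec, dotProduct, mul_comm]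
  have hsum : (fun a => (external A *ᵥ x + external B *ᵥ u) ⟨i, a⟩)
      = (fun a => (external A *ᵥ x) ⟨i, a⟩) + fun a => (external B *ᵥ u) ⟨i, a⟩ := rfl
  rw [hsum, hsub, hsub]
  refine Submodule.add_mem _ (Submodule.sum_mem _ fun c _ => Submodule.smul_mem _ _ ?_)
    (Submodule.sum_mem _ fun c _ => Submodule.smul_mem _ _ ?_)
  all_goals
    obtain ⟨j, b⟩ := c
    by_cases hj : i = j
    · convert Submodule.zero_mem _
      simp [external, hj]
  · refine Submodule.subset_span ⟨Sum.inl ⟨⟨j, Ne.symm hj⟩, b⟩, ?_⟩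
    funext a
    simp [external, hj, extBlockRow, Matrix.col]
  · refine Submodule.subset_span ⟨Sum.inr ⟨⟨j, Ne.symm hj⟩, b⟩, ?_⟩
    funext a
    simp [external, hj, extBlockRow, Matrix.col]

end Blocks

namespace Decomposition

open MPCProblem

variable {N M : ℕ} {nx nu : Fin M → ℕ} {P : MPCProblem N (Σ i, Fin (nx i)) (Σ i, Fin (nu i))}

/-- The virtual inputs of all subsystems at time `k`. -/
def virt (T : Decomposition P) (y : T.Idx → ℝ) (k : Fin N) : (Σ i, Fin (T.nw i)) → ℝ :=
  fun b => y ⟨b.1, (k, Sum.inl (Sum.inr b.2))⟩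

/-- The residual of the coupling constraint before the removal of linearly dependent rows. -/
def couplingRes (T : Decomposition P) (y : T.Idx → ℝ) (k : Fin N) : (Σ i, Fin (nx i)) → ℝ :=
  external P.A *ᵥ P.prev (T.traj y).1 k + external P.B *ᵥ (T.traj y).2 k
    - Matrix.blockDiagonal' T.W *ᵥ T.virt y k

theorem prev_subsystem (T : Decomposition P) (y : T.Idx → ℝ) (i : Fin M) (k : Fin N) :
    (T.subsystem i).prev (unstack (T.blk y i)).1 k = fun a => P.prev (T.traj y).1 k ⟨i, a⟩ := by
  by_cases hk : (k : ℕ) = 0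
  · rw [prev_of_eq_zero _ _ hk, prev_of_eq_zero _ _ hk]; rfl
  · have hl : ((⟨k - 1, by omega⟩ : Fin N) : ℕ) + 1 = k := by simp; omega
    rw [prev_of_succ_eq _ _ hl, prev_of_succ_eq _ _ hl]; rfl

/-- The residual of the full dynamics is the sum of the residuals of the virtual subsystems and of
the coupling constraint: the virtual inputs cancel. -/
theorem residual_traj (T : Decomposition P) (y : T.Idx → ℝ) (k : Fin N) (i : Fin M)
    (a : Fin (nx i)) : P.residual (T.traj y) k ⟨i, a⟩
      = (T.subsystem i).residual (unstack (T.blk y i)) k a + T.couplingRes y k ⟨i, a⟩ := by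
  have h1 : (T.subsystem i).B *ᵥ (unstack (T.blk y i)).2 k
      = (Matrix.of (fun a b => P.B ⟨i, a⟩ ⟨i, b⟩) *ᵥ fun b => (T.traj y).2 k ⟨i, b⟩)
        + T.W i *ᵥ fun b => T.virt y k ⟨i, b⟩ := by
    have : (T.subsystem i).B = Matrix.fromCols (Matrix.of (fun a b => P.B ⟨i, a⟩ ⟨i, b⟩)) (T.W i) :=
      rfl
    rw [this, Matrix.fromCols_mulVec]
    rfl
  simp only [MPCProblem.residual, couplingRes, Pi.sub_apply, Pi.add_apply]
  rw [mulVec_eq_block_add_external P.A, mulVec_eq_block_add_external P.B, blockDiagonal'_mulVec,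
    h1, prev_subsystem]
  simp only [Pi.add_apply]
  have h2 : (unstack (T.blk y i)).1 k a = (T.traj y).1 k ⟨i, a⟩ := rfl
  have h3 : (T.subsystem i).A = Matrix.of (fun a b => P.A ⟨i, a⟩ ⟨i, b⟩) := rfl
  rw [h2, h3]
  ring

theorem couplingD_mulVec_sub (T : Decomposition P) (y : T.Idx → ℝ) (k : Fin N) (r : T.rows) :
    (T.couplingD *ᵥ y) (k, r) - T.couplingRhs (k, r) = T.couplingRes y k r := by
  have h1 : (T.couplingD *ᵥ y) (k, r)
      = (external P.B *ᵥ (T.traj y).2 k) r - (Matrix.blockDiagonal' T.W *ᵥ T.virt y k) r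
        + ∑ l : Fin N, ∑ a, (if (l : ℕ) + 1 = k then external P.A r a else 0)
          * (T.traj y).1 l a := by
    rw [Finset.sum_comm]
    simp only [Matrix.mulVec, dotProduct, Fintype.sum_sigma, Fintype.sum_prod_type,
      Fintype.sum_sum_type, couplingD, Matrix.of_apply, Finset.sum_add_distrib, traj, virt,
      ite_mul, zero_mul, neg_mul]
    simp [Finset.sum_ite_irrel, sub_eq_add_neg]
    refine Finset.sum_congr rfl fun i _ => Eq.trans ?_ Finset.sum_comm
    exact Finset.sum_congr rfl fun l _ => by split_ifs <;> simp
  rw [h1, couplingRes, Pi.sub_apply, Pi.add_apply, P.mulVec_prev]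
  by_cases hk : (k : ℕ) = 0 <;> simp [couplingRhs, hk] <;> ring

/-- Multipliers for all coupling rows can be replaced by multipliers for the remaining rows. -/
theorem exists_coupling_multiplier (T : Decomposition P) (p : Fin N → (Σ i, Fin (nx i)) → ℝ) :
    ∃ η : Fin N × T.rows → ℝ, ∀ y, ∑ k, p k ⬝ᵥ T.couplingRes y k
      = η ⬝ᵥ (T.couplingD *ᵥ y - T.couplingRhs) := by
  set G := Matrix.fromCols (Matrix.fromCols (external P.A) (external P.B))
    (Matrix.blockDiagonal' T.W) with hG
  have hspan : ∀ r, ∃ c : T.rows → ℝ, ∑ s, c s • G.row s = G.row r := fun r => by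
    have h1 : G.row r ∈ Submodule.span ℝ (Set.range G.row) := Submodule.subset_span ⟨r, rfl⟩
    rw [← T.rows_span] at h1
    exact (Submodule.mem_span_range_iff_exists_fun ℝ).1 h1
  choose c hc using hspan
  have hres : ∀ y k r, T.couplingRes y k r = G.row r ⬝ᵥ
      Sum.elim (Sum.elim (P.prev (T.traj y).1 k) ((T.traj y).2 k)) (-T.virt y k) := by
    intro y k r
    have h1 : T.couplingRes y k = G *ᵥ
        Sum.elim (Sum.elim (P.prev (T.traj y).1 k) ((T.traj y).2 k)) (-T.virt y k) := by
      rw [hG, Matrix.fromCols_mulVec, Sum.elim_comp_inl, Sum.elim_comp_inr,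
        Matrix.fromCols_mulVec, Sum.elim_comp_inl, Sum.elim_comp_inr, Matrix.mulVec_neg,
        ← sub_eq_add_neg]
      rfl
    rw [h1]
    rfl
  have hres' : ∀ y k r, T.couplingRes y k r = ∑ s, c r s * T.couplingRes y k s := by
    intro y k r
    rw [hres, ← hc r, sum_dotProduct]
    exact Finset.sum_congr rfl fun s _ => by rw [smul_dotProduct, hres, smul_eq_mul]
  refine ⟨fun ks => ∑ r, p ks.1 r * c r ks.2, fun y => ?_⟩
  rw [dotProduct, Fintype.sum_prod_type]
  refine Finset.sum_congr rfl fun k _ => ?_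
  simp only [dotProduct, Pi.sub_apply, couplingD_mulVec_sub, Finset.sum_mul]
  rw [Finset.sum_comm]
  refine Finset.sum_congr rfl fun r _ => ?_
  rw [hres', Finset.mul_sum]
  exact Finset.sum_congr rfl fun s _ => by ring

theorem couplingD_mulVec_eq_iff (T : Decomposition P) (y : T.Idx → ℝ) :
    T.couplingD *ᵥ y = T.couplingRhs ↔ ∀ k, T.couplingRes y k = 0 := by
  constructor
  · intro h
    obtain ⟨η, hη⟩ := T.exists_coupling_multiplier (T.couplingRes y)
    have h1 := hη y
    rw [h, sub_self, dotProduct_zero] at h1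
    intro k
    have h2 := (Finset.sum_eq_zero_iff_of_nonneg fun k _ =>
      Finset.sum_nonneg fun a _ => mul_self_nonneg (T.couplingRes y k a)).1 h1 k
      (Finset.mem_univ k)
    exact dotProduct_self_eq_zero.1 h2
  · intro h
    funext ⟨k, r⟩
    rw [← sub_eq_zero, couplingD_mulVec_sub, h k, Pi.zero_apply]

/-- Every trajectory can be completed by virtual inputs that satisfy the coupling constraint. -/
theorem exists_traj_eq (T : Decomposition P) (z : Traj N (Σ i, Fin (nx i)) (Σ i, Fin (nu i))) :
    ∃ y : T.Idx → ℝ, T.traj y = z ∧ ∀ k, T.couplingRes y k = 0 := by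
  have h : ∀ k i, ∃ w : Fin (T.nw i) → ℝ, ∑ b, w b • (T.W i).col b
      = fun a => (external P.A *ᵥ P.prev z.1 k + external P.B *ᵥ z.2 k) ⟨i, a⟩ := fun k i => by
    have h1 := external_mulVec_mem_span P.A P.B (P.prev z.1 k) (z.2 k) i
    rw [← T.W_span] at h1
    exact (Submodule.mem_span_range_iff_exists_fun ℝ).1 h1
  choose w hw using h
  refine ⟨fun j => match j with
    | ⟨i, (k, Sum.inl (Sum.inl b))⟩ => z.2 k ⟨i, b⟩
    | ⟨i, (k, Sum.inl (Sum.inr b))⟩ => w k i b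
    | ⟨i, (k, Sum.inr a)⟩ => z.1 k ⟨i, a⟩, rfl, fun k => ?_⟩
  funext ⟨i, a⟩
  have h1 : (T.W i *ᵥ w k i) a = (∑ b, w k i b • (T.W i).col b) a := by
    simp [Matrix.mulVec, dotProduct, mul_comm]
  rw [couplingRes, Pi.sub_apply, blockDiagonal'_mulVec, Pi.zero_apply, sub_eq_zero]
  exact ((h1.trans (congrFun (hw k i) a))).symm

theorem Q_isSymm (T : Decomposition P) (hP : P.IsConvex) (i : Fin M) : (T.Q i).IsSymm := by
  refine Matrix.IsSymm.ext fun a b => ?_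
  have h1 := hP.Q_psd.isHermitian.apply ⟨i, a⟩ ⟨i, b⟩
  simpa [T.Q_eq, Matrix.blockDiagonal'_apply_eq] using h1

theorem R_isSymm (T : Decomposition P) (hP : P.IsConvex) (i : Fin M) : (T.R i).IsSymm := by
  refine Matrix.IsSymm.ext fun a b => ?_
  have h1 := hP.R_psd.isHermitian.apply ⟨i, a⟩ ⟨i, b⟩
  simpa [T.R_eq, Matrix.blockDiagonal'_apply_eq] using h1

theorem subsystem_R_isSymm (T : Decomposition P) (hP : P.IsConvex) (i : Fin M) :
    (T.subsystem i).R.IsSymm := by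
  have : (T.subsystem i).R = Matrix.fromBlocks (T.R i) 0 0 0 := rfl
  rw [this, Matrix.IsSymm, Matrix.fromBlocks_transpose, (T.R_isSymm hP i).eq]
  simp

/-- The Hessian of the split problem. -/
noncomputable def splitH (T : Decomposition P) : Matrix T.Idx T.Idx ℝ :=
  Matrix.blockDiagonal' fun i => (T.subsystem i).stackQ

/-- The linear term of the objective of the split problem. -/
noncomputable def splitLin (T : Decomposition P) : T.Idx → ℝ :=
  fun j => (T.subsystem j.1).stackLin j.2

theorem quad_splitH (T : Decomposition P) (y : T.Idx → ℝ) :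
    quad T.splitH T.splitLin y = ∑ i, (T.subsystem i).stackObj (T.blk y i) := by
  simp only [stackObj, Finset.sum_add_distrib, quad, splitH, dotProduct_blockDiagonal'_mulVec,
    Finset.mul_sum]
  congr 1
  rw [dotProduct, Fintype.sum_sigma]
  rfl

theorem splitH_isSymm (T : Decomposition P) (hP : P.IsConvex) : T.splitH.IsSymm := by
  unfold splitH Matrix.IsSymm
  rw [Matrix.blockDiagonal'_transpose]
  congr 1
  funext i
  exact stackQ_isSymm _ (T.Q_isSymm hP i) (T.subsystem_R_isSymm hP i)

theorem dotProduct_splitH_mulVec (T : Decomposition P) (v w : T.Idx → ℝ) :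
    v ⬝ᵥ T.splitH *ᵥ w = ∑ k, ((T.traj v).1 k ⬝ᵥ P.Q *ᵥ (T.traj w).1 k
      + (T.traj v).2 k ⬝ᵥ P.R *ᵥ (T.traj w).2 k) := by
  rw [splitH, dotProduct_blockDiagonal'_mulVec]
  simp only [dotProduct_stackQ_mulVec, T.Q_eq, T.R_eq, dotProduct_blockDiagonal'_mulVec]
  rw [Finset.sum_comm]
  refine Finset.sum_congr rfl fun k _ => ?_
  rw [← Finset.sum_add_distrib]
  refine Finset.sum_congr rfl fun i _ => ?_
  congr 1
  exact dotProduct_fromBlocks_mulVec_inl _ _ _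

theorem splitH_nonneg (T : Decomposition P) (hP : P.IsConvex) (v : T.Idx → ℝ) :
    0 ≤ v ⬝ᵥ T.splitH *ᵥ v := by
  rw [dotProduct_splitH_mulVec]
  refine Finset.sum_nonneg fun k _ => add_nonneg ?_ ?_
  · simpa using hP.Q_psd.dotProduct_mulVec_nonneg ((T.traj v).1 k)
  · simpa using hP.R_psd.dotProduct_mulVec_nonneg ((T.traj v).2 k)

theorem sum_stackObj_add_stackConst (T : Decomposition P) (hP : P.IsConvex) (y : T.Idx → ℝ) :
    ∑ i, ((T.subsystem i).stackObj (T.blk y i) + (T.subsystem i).stackConst)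
      = P.objective (T.traj y) := by
  simp only [fun i => stackObj_add_stackConst (T.subsystem i) (T.Q_isSymm hP i)
    (T.subsystem_R_isSymm hP i), objective, T.Q_eq, T.R_eq, dotProduct_blockDiagonal'_mulVec]
  rw [Finset.sum_comm]
  refine Finset.sum_congr rfl fun k _ => ?_
  rw [Finset.mul_sum, Finset.mul_sum, ← Finset.sum_add_distrib]
  refine Finset.sum_congr rfl fun i _ => ?_
  congr 2
  exact dotProduct_fromBlocks_mulVec_inl _ _ _

theorem forall_blk_mem_stackY_iff (T : Decomposition P) (y : T.Idx → ℝ) :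
    (∀ i, T.blk y i ∈ (T.subsystem i).stackY) ↔ T.traj y ∈ P.constraintSet := by
  have h1 : T.traj y ∈ P.constraintSet ↔ ∀ k, (T.traj y).1 k ∈ P.X ∧ (T.traj y).2 k ∈ P.U :=
    Iff.rfl
  rw [h1, T.X_eq, T.U_eq]
  constructor
  · exact fun h k => ⟨fun i => (h i k).2, fun i => (h i k).1⟩
  · exact fun h i k => ⟨(h k).2 i, (h k).1 i⟩

end Decomposition

/-! ### Structure-exploiting ADMM as ADMM for a consensus problem -/

/-- A sum of functions of different blocks is minimized over a product set blockwise. -/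
theorem isMinOn_sum_iff {σ : Type} [Fintype σ] [DecidableEq σ] {κ : σ → Type}
    {F : ∀ i, (κ i → ℝ) → ℝ} {S : ∀ i, Set (κ i → ℝ)} {p : (Σ i, κ i) → ℝ}
    (hp : ∀ i, (fun j => p ⟨i, j⟩) ∈ S i) :
    IsMinOn (fun v : (Σ i, κ i) → ℝ => ∑ i, F i fun j => v ⟨i, j⟩)
      {v | ∀ i, (fun j => v ⟨i, j⟩) ∈ S i} p ↔ ∀ i, IsMinOn (F i) (S i) fun j => p ⟨i, j⟩ := by
  simp only [isMinOn_iff]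
  constructor
  · intro h i w hw
    have hne : ∀ j, j ≠ i → Function.update (fun i j => p ⟨i, j⟩) i w j = fun a => p ⟨j, a⟩ :=
      fun j hj => Function.update_of_ne hj _ _
    have h1 := h (fun j => Function.update (fun i j => p ⟨i, j⟩) i w j.1 j.2) fun j => by
      by_cases hj : j = i
      · subst hj
        simpa using hw
      · simpa [hne j hj] using hp j
    rw [← Finset.add_sum_erase _ _ (Finset.mem_univ i),
      ← Finset.add_sum_erase _ _ (Finset.mem_univ i)] at h1
    have h2 : ∑ j ∈ Finset.univ.erase i, F j (Function.update (fun i j => p ⟨i, j⟩) i w j)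
        = ∑ j ∈ Finset.univ.erase i, F j fun a => p ⟨j, a⟩ :=
      Finset.sum_congr rfl fun j hj => by rw [hne j (Finset.ne_of_mem_erase hj)]
    simp only [Function.update_self] at h1
    linarith
  · exact fun h v hv => Finset.sum_le_sum fun i _ => h i _ (hv i)

theorem isMinOn_add_iff {ι κ : Type} {F : (ι → ℝ) → ℝ} {G : (κ → ℝ) → ℝ} {S : Set (ι → ℝ)}
    {K : Set (κ → ℝ)} {p : ι → ℝ} {q : κ → ℝ} (hp : p ∈ S) (hq : q ∈ K) :
    IsMinOn (fun v : ι ⊕ κ → ℝ => F (v ∘ Sum.inl) + G (v ∘ Sum.inr))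
      {v | v ∘ Sum.inl ∈ S ∧ v ∘ Sum.inr ∈ K} (Sum.elim p q)
      ↔ IsMinOn F S p ∧ IsMinOn G K q := by
  simp only [isMinOn_iff]
  constructor
  · intro h
    refine ⟨fun v hv => ?_, fun v hv => ?_⟩
    · have := h (Sum.elim v q) ⟨by simpa using hv, by simpa using hq⟩
      simpa using this
    · have := h (Sum.elim p v) ⟨by simpa using hp, by simpa using hv⟩
      simpa using this
  · rintro ⟨h1, h2⟩ v ⟨hv1, hv2⟩
    simpa using add_le_add (h1 _ hv1) (h2 _ hv2)

theorem isMinOn_const_mul_iff {α : Type} {f : α → ℝ} {S : Set α} {a : α} {c : ℝ} (hc : 0 < c) :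
    IsMinOn (fun v => c * f v) S a ↔ IsMinOn f S a := by
  simp only [isMinOn_iff, mul_le_mul_iff_right₀ hc]

theorem isMinOn_add_const_iff {α : Type} {f : α → ℝ} {S : Set α} {a : α} (c : ℝ) :
    IsMinOn (fun v => f v + c) S a ↔ IsMinOn f S a := by
  simp only [isMinOn_iff, add_le_add_iff_right]

namespace Decomposition

open MPCProblem

variable {N M : ℕ} {nx nu : Fin M → ℕ} {P : MPCProblem N (Σ i, Fin (nx i)) (Σ i, Fin (nu i))}

/-- The split problem as a consensus problem: `ζ` and `ε` are two copies of `y`. -/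
noncomputable def consensus (T : Decomposition P) (β : ℝ) (ρ : Fin M → ℝ) :
    ConsensusProblem T.Idx (T.Idx ⊕ T.Idx) where
  H := T.splitH
  g := T.splitLin
  S := {y | ∀ i, (T.subsystem i).stackC *ᵥ T.blk y i = (T.subsystem i).stackRhs}
  K := {z | (∀ i, T.blk (z ∘ Sum.inl) i ∈ (T.subsystem i).stackY)
    ∧ T.couplingD *ᵥ (z ∘ Sum.inr) = T.couplingRhs}
  c := Sum.elim id id
  E := Sum.elim (fun j => β * ρ j.1) fun j => (1 - β) * ρ j.1

theorem forall_stackC_eq_iff (T : Decomposition P) (y : T.Idx → ℝ) :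
    (∀ i, (T.subsystem i).stackC *ᵥ T.blk y i = (T.subsystem i).stackRhs) ↔
      ∀ k i a, P.residual (T.traj y) k ⟨i, a⟩ = T.couplingRes y k ⟨i, a⟩ := by
  simp only [stackC_mulVec_eq_iff]
  simp only [residual_traj, add_eq_right, funext_iff, Pi.zero_apply]
  exact forall_comm

theorem convex_constraintSet (hP : P.IsConvex) : Convex ℝ P.constraintSet :=
  fun _ hz _ hw _ _ ha hb hab k =>
    ⟨hP.X_convex (hz k).1 (hw k).1 ha hb hab, hP.U_convex (hz k).2 (hw k).2 ha hb hab⟩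

theorem isClosed_constraintSet (hX : IsClosed P.X) (hU : IsClosed P.U) :
    IsClosed P.constraintSet := by
  have : P.constraintSet = ⋂ k, {z | z.1 k ∈ P.X} ∩ {z | z.2 k ∈ P.U} := by
    ext z
    simp [constraintSet]
  rw [this]
  exact isClosed_iInter fun k => (hX.preimage (by fun_prop)).inter (hU.preimage (by fun_prop))

theorem convex_setOf_mulVec_eq {ι κ : Type} [Fintype ι] (D : Matrix κ ι ℝ) (d : κ → ℝ) :
    Convex ℝ {v | D *ᵥ v = d} := by
  intro v hv w hw a b _ _ hab
  have hv' : D *ᵥ v = d := hv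
  have hw' : D *ᵥ w = d := hw
  change D *ᵥ (a • v + b • w) = d
  rw [Matrix.mulVec_add, Matrix.mulVec_smul, Matrix.mulVec_smul, hv', hw', ← add_smul, hab,
    one_smul]

theorem isClosed_setOf_mulVec_eq {ι κ : Type} [Fintype ι] (D : Matrix κ ι ℝ) (d : κ → ℝ) :
    IsClosed {v | D *ᵥ v = d} :=
  isClosed_eq (continuous_const.matrix_mulVec continuous_id) continuous_const

theorem mem_feasibleSet_iff (z : Traj N (Σ i, Fin (nx i)) (Σ i, Fin (nu i))) :
    z ∈ P.feasibleSet ↔ (∀ k, P.residual z k = 0) ∧ z ∈ P.constraintSet := by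
  have : z ∈ P.feasibleSet ↔ (∀ k, z.1 k = P.A *ᵥ P.prev z.1 k + P.B *ᵥ z.2 k)
    ∧ z ∈ P.constraintSet := Iff.rfl
  simp only [this, MPCProblem.residual, sub_eq_zero, eq_comm]

/-- Feasible trajectories can be completed by virtual inputs to feasible points of the split
problem. -/
theorem exists_mem_splitFeasibleSet (T : Decomposition P)
    {z : Traj N (Σ i, Fin (nx i)) (Σ i, Fin (nu i))} (hz : z ∈ P.feasibleSet) :
    ∃ y, T.traj y = z ∧ (y, y, y) ∈ T.splitFeasibleSet := by
  obtain ⟨y, rfl, hy⟩ := T.exists_traj_eq z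
  obtain ⟨h1, h2⟩ := (mem_feasibleSet_iff _).1 hz
  exact ⟨y, rfl, (T.forall_stackC_eq_iff y).2 fun k i a => by rw [h1, hy],
    (T.forall_blk_mem_stackY_iff y).2 h2, (T.couplingD_mulVec_eq_iff y).2 hy, rfl, rfl⟩

theorem traj_mem_feasibleSet (T : Decomposition P) {y : T.Idx → ℝ}
    (hy : (y, y, y) ∈ T.splitFeasibleSet) : T.traj y ∈ P.feasibleSet := by
  obtain ⟨h1, h2, h3, -, -⟩ := hy
  refine (mem_feasibleSet_iff _).2 ⟨fun k => ?_, (T.forall_blk_mem_stackY_iff y).1 h2⟩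
  funext ⟨i, a⟩
  rw [(T.forall_stackC_eq_iff y).1 h1, (T.couplingD_mulVec_eq_iff y).1 h3]

theorem consensus_regular (T : Decomposition P) (hP : P.IsConvex) (hfeas : P.feasibleSet.Nonempty)
    (hX : IsClosed P.X) (hU : IsClosed P.U) {β : ℝ} {ρ : Fin M → ℝ} (hβ : 0 < β) (hβ' : β < 1)
    (hρ : ∀ i, 0 < ρ i) : (T.consensus β ρ).Regular := by
  obtain ⟨z, hz⟩ := hfeas
  obtain ⟨y, -, hy⟩ := T.exists_mem_splitFeasibleSet hz
  have hS : (T.consensus β ρ).S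
      = ⋂ i, {y | (T.subsystem i).stackC *ᵥ T.blk y i = (T.subsystem i).stackRhs} := by
    ext y
    simp [consensus]
  have hK : (T.consensus β ρ).K = (fun z => T.traj (z ∘ Sum.inl)) ⁻¹' P.constraintSet
      ∩ (fun z => z ∘ Sum.inr) ⁻¹' {v | T.couplingD *ᵥ v = T.couplingRhs} := by
    ext z
    simp [consensus, forall_blk_mem_stackY_iff]
  exact
  { H_symm := T.splitH_isSymm hP
    H_nonneg := T.splitH_nonneg hP
    S_convex := by
      rw [hS]
      exact convex_iInter fun i _ hv _ hw a b ha hb hab =>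
        convex_setOf_mulVec_eq (T.subsystem i).stackC _ hv hw ha hb hab
    S_closed := by
      rw [hS]
      refine isClosed_iInter fun i =>
        (isClosed_setOf_mulVec_eq (T.subsystem i).stackC _).preimage (f := fun y => T.blk y i) ?_
      unfold blk
      fun_prop
    S_nonempty := ⟨y, hy.1⟩
    K_convex := by
      rw [hK]
      exact Convex.inter
        (fun v hv w hw a b ha hb hab => convex_constraintSet hP hv hw ha hb hab)
        (fun v hv w hw a b ha hb hab => convex_setOf_mulVec_eq T.couplingD _ hv hw ha hb hab)
    K_closed := by
      rw [hK]
      refine ((isClosed_constraintSet hX hU).preimage ?_).inter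
        ((isClosed_setOf_mulVec_eq _ _).preimage ?_)
      · unfold traj
        simp only [Function.comp]
        fun_prop
      · simp only [Function.comp_def]
        fun_prop
    K_nonempty := ⟨Sum.elim y y, by simpa using hy.2.1, by simpa using hy.2.2.1⟩
    c_surj := fun j => ⟨Sum.inl j, rfl⟩
    E_pos := by
      rintro (j | j)
      · exact mul_pos hβ (hρ _)
      · exact mul_pos (by linarith) (hρ _) }

theorem sum_mul_sqNorm_blk (T : Decomposition P) (a : Fin M → ℝ) (v : T.Idx → ℝ) :
    ∑ i, a i * sqNorm (T.blk v i) = ∑ j, a j.1 * v j ^ 2 := by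
  rw [Fintype.sum_sigma]
  refine Finset.sum_congr rfl fun i _ => ?_
  rw [sqNorm, dotProduct, Finset.mul_sum]
  exact Finset.sum_congr rfl fun j _ => by rw [sq]; rfl

theorem sum_augmented_eq_yObj (T : Decomposition P) (β : ℝ) (ρ : Fin M → ℝ)
    (ζ ε lζ lε v : T.Idx → ℝ) :
    ∑ i, ((T.subsystem i).stackObj (T.blk v i) + ρ i / 2 *
      (β * sqNorm (T.blk v i - T.blk ζ i - T.blk lζ i)
        + (1 - β) * sqNorm (T.blk v i - T.blk ε i - T.blk lε i)))
      = (T.consensus β ρ).yObj (Sum.elim ζ ε + Sum.elim lζ lε) v := by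
  have h1 := T.sum_mul_sqNorm_blk (fun i => β * ρ i) (v - ζ - lζ)
  have h2 := T.sum_mul_sqNorm_blk (fun i => (1 - β) * ρ i) (v - ε - lε)
  have h3 : (T.consensus β ρ).yObj (Sum.elim ζ ε + Sum.elim lζ lε) v
      = quad T.splitH T.splitLin v + 1 / 2 * (∑ j : T.Idx, β * ρ j.1 * (v - ζ - lζ) j ^ 2
        + ∑ j : T.Idx, (1 - β) * ρ j.1 * (v - ε - lε) j ^ 2) := by
    simp [ConsensusProblem.yObj, consensus, sub_sub]
  rw [h3, ← h1, ← h2, quad_splitH, ← Finset.sum_add_distrib, Finset.mul_sum,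
    ← Finset.sum_add_distrib]
  refine Finset.sum_congr rfl fun i _ => ?_
  have h4 : ∀ x y z : T.Idx → ℝ, T.blk (x - y - z) i = T.blk x i - T.blk y i - T.blk z i :=
    fun _ _ _ => rfl
  rw [h4, h4]
  ring

/-- The projection of `z` onto the product of the sets `Y i`, with a positive weight for each
block. -/
theorem forall_isProj_iff (T : Decomposition P) {a : Fin M → ℝ} (ha : ∀ i, 0 < a i)
    (z p : T.Idx → ℝ) :
    (∀ i, IsProj (T.subsystem i).stackY (T.blk z i) (T.blk p i)) ↔
      (∀ i, T.blk p i ∈ (T.subsystem i).stackY) ∧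
        IsMinOn (fun v : T.Idx → ℝ => ∑ j, a j.1 * (z j - v j) ^ 2)
          {v | ∀ i, T.blk v i ∈ (T.subsystem i).stackY} p := by
  simp only [IsProj, forall_and]
  refine and_congr_right fun hp => ?_
  have h1 := isMinOn_sum_iff (F := fun i v => a i * sqNorm (T.blk z i - v))
    (S := fun i => (T.subsystem i).stackY) (p := p) hp
  have h2 : ∀ v : T.Idx → ℝ, ∑ j, a j.1 * (z j - v j) ^ 2
      = ∑ i, a i * sqNorm (T.blk z i - fun j => v ⟨i, j⟩) :=
    fun v => (T.sum_mul_sqNorm_blk a (z - v)).symm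
  simp only [h2]
  exact (h1.trans (forall_congr' fun i => isMinOn_const_mul_iff (ha i))).symm

/-- The updates of the blocks of `y` and `ζ` are separable, and the scaling of the distance to
`Y i` by a positive weight does not change the projection. -/
theorem step_iff (T : Decomposition P) {β : ℝ} {ρ : Fin M → ℝ} (hβ : 0 < β)
    (hρ : ∀ i, 0 < ρ i) (s s' : T.State) : T.Step β ρ s s' ↔
      (T.consensus β ρ).Step (Sum.elim s.ζ s.ε) (Sum.elim s.lamζ s.lamε) s'.y
        (Sum.elim s'.ζ s'.ε) (Sum.elim s'.lamζ s'.lamε) := by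
  have hy : (∀ i, (T.subsystem i).stackC *ᵥ T.blk s'.y i = (T.subsystem i).stackRhs) →
      ((∀ i, IsMinOn (fun v => (T.subsystem i).stackObj v + ρ i / 2 *
        (β * sqNorm (v - T.blk s.ζ i - T.blk s.lamζ i)
          + (1 - β) * sqNorm (v - T.blk s.ε i - T.blk s.lamε i)))
        {v | (T.subsystem i).stackC *ᵥ v = (T.subsystem i).stackRhs} (T.blk s'.y i)) ↔
      IsMinOn ((T.consensus β ρ).yObj (Sum.elim s.ζ s.ε + Sum.elim s.lamζ s.lamε))
        (T.consensus β ρ).S s'.y) := fun h => by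
    have h1 := isMinOn_sum_iff (F := fun i v => (T.subsystem i).stackObj v + ρ i / 2 *
        (β * sqNorm (v - T.blk s.ζ i - T.blk s.lamζ i)
          + (1 - β) * sqNorm (v - T.blk s.ε i - T.blk s.lamε i)))
      (S := fun i => {v | (T.subsystem i).stackC *ᵥ v = (T.subsystem i).stackRhs})
      (p := s'.y) h
    have h2 : (T.consensus β ρ).yObj (Sum.elim s.ζ s.ε + Sum.elim s.lamζ s.lamε) = _ :=
      funext fun v => (T.sum_augmented_eq_yObj β ρ s.ζ s.ε s.lamζ s.lamε v).symm
    rw [h2]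
    exact h1.symm
  have hz := T.forall_isProj_iff (fun i => mul_pos hβ (hρ i)) (s'.y - s.lamζ) s'.ζ
  have hz' : (∀ i, T.blk s'.ζ i ∈ (T.subsystem i).stackY) →
      T.couplingD *ᵥ s'.ε = T.couplingRhs →
      (IsMinOn ((T.consensus β ρ).zObj (s'.y ∘ (T.consensus β ρ).c - Sum.elim s.lamζ s.lamε))
        (T.consensus β ρ).K (Sum.elim s'.ζ s'.ε) ↔
      IsMinOn (fun v : T.Idx → ℝ => ∑ j, β * ρ j.1 * ((s'.y - s.lamζ) j - v j) ^ 2)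
          {v | ∀ i, T.blk v i ∈ (T.subsystem i).stackY} s'.ζ ∧
        IsMinOn (fun v : T.Idx → ℝ => ∑ j, (1 - β) * ρ j.1 * ((s'.y - s.lamε) j - v j) ^ 2)
          {v | T.couplingD *ᵥ v = T.couplingRhs} s'.ε) := fun h1 h2 => by
    have h4 := isMinOn_add_iff
      (F := fun v : T.Idx → ℝ => ∑ j, β * ρ j.1 * ((s'.y - s.lamζ) j - v j) ^ 2)
      (G := fun v : T.Idx → ℝ => ∑ j, (1 - β) * ρ j.1 * ((s'.y - s.lamε) j - v j) ^ 2)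
      (S := {v | ∀ i, T.blk v i ∈ (T.subsystem i).stackY})
      (K := {v | T.couplingD *ᵥ v = T.couplingRhs}) (p := s'.ζ) (q := s'.ε) h1 h2
    have h3 : (T.consensus β ρ).zObj (s'.y ∘ (T.consensus β ρ).c - Sum.elim s.lamζ s.lamε)
        = fun v => ∑ j, β * ρ j.1 * ((s'.y - s.lamζ) j - (v ∘ Sum.inl) j) ^ 2
          + ∑ j, (1 - β) * ρ j.1 * ((s'.y - s.lamε) j - (v ∘ Sum.inr) j) ^ 2 := by
      funext v
      simp [ConsensusProblem.zObj, consensus]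
    rw [h3]
    exact h4
  have hl : Sum.elim s'.lamζ s'.lamε = Sum.elim s.lamζ s.lamε
      - (s'.y ∘ (T.consensus β ρ).c - Sum.elim s'.ζ s'.ε) ↔
      s'.lamζ = s.lamζ - (s'.y - s'.ζ) ∧ s'.lamε = s.lamε - (s'.y - s'.ε) := by
    simp [funext_iff, Sum.forall, consensus]
  constructor
  · intro h
    have h1 := hz.1 h.ζ_proj
    exact ⟨h.y_feas, (hy h.y_feas).1 h.y_min, ⟨by simpa using h1.1, by simpa using h.ε_proj.1⟩,
      (hz' h1.1 h.ε_proj.1).2 ⟨h1.2, h.ε_proj.2⟩, hl.2 ⟨h.lamζ_eq, h.lamε_eq⟩⟩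
  · intro h
    have h1 : ∀ i, T.blk s'.ζ i ∈ (T.subsystem i).stackY := by simpa using h.z_mem.1
    have h2 : T.couplingD *ᵥ s'.ε = T.couplingRhs := by simpa using h.z_mem.2
    have h3 := (hz' h1 h2).1 h.z_min
    have h4 := hl.1 h.l_eq
    exact ⟨h.y_mem, (hy h.y_mem).2 h.y_min, hz.2 ⟨h1, h3.1⟩, ⟨h2, h3.2⟩, h4.1, h4.2⟩

theorem existsUnique_step (T : Decomposition P) {β : ℝ} {ρ : Fin M → ℝ} (hβ : 0 < β)
    (hρ : ∀ i, 0 < ρ i) (hC : (T.consensus β ρ).Regular) (s : T.State) :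
    ∃! s', T.Step β ρ s s' := by
  obtain ⟨y', z', l', h⟩ :=
    ConsensusProblem.exists_step hC (Sum.elim s.ζ s.ε) (Sum.elim s.lamζ s.lamε)
  refine ⟨⟨y', z' ∘ Sum.inl, z' ∘ Sum.inr, l' ∘ Sum.inl, l' ∘ Sum.inr⟩, ?_, fun s' hs' => ?_⟩
  · refine (T.step_iff hβ hρ _ _).2 ?_
    simpa only [Sum.elim_comp_inl_inr] using h
  · obtain ⟨h1, h2, h3⟩ := ((T.step_iff hβ hρ _ _).1 hs').unique hC h
    subst h1 h2 h3
    rfl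

/-! ### Saddle points, fixed points and optimality -/

/-- At a saddle point of the Lagrangian the dynamics hold. -/
theorem residual_eq_zero_of_forall_lagrangian_le
    {z : Traj N (Σ i, Fin (nx i)) (Σ i, Fin (nu i))} {p : Fin N → (Σ i, Fin (nx i)) → ℝ}
    (h : ∀ p', P.lagrangian z p' ≤ P.lagrangian z p) (k : Fin N) : P.residual z k = 0 := by
  have h1 := h (p + P.residual z)
  simp only [lagrangian, Pi.add_apply, add_dotProduct, Finset.sum_add_distrib] at h1
  have h2 : ∀ k, 0 ≤ P.residual z k ⬝ᵥ P.residual z k := fun k =>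
    Finset.sum_nonneg fun a _ => mul_self_nonneg _
  have h3 : ∑ k, P.residual z k ⬝ᵥ P.residual z k = 0 :=
    le_antisymm (by linarith) (Finset.sum_nonneg fun k _ => h2 k)
  exact dotProduct_self_eq_zero.1
    ((Finset.sum_eq_zero_iff_of_nonneg fun k _ => h2 k).1 h3 k (Finset.mem_univ k))

/-- Multipliers for the dynamics of the MPC problem act as multipliers for the dynamics of the
virtual subsystems and for the coupling constraint. -/
theorem sum_dotProduct_residual_traj (T : Decomposition P) (p : Fin N → (Σ i, Fin (nx i)) → ℝ)
    (y : T.Idx → ℝ) : ∑ k, p k ⬝ᵥ P.residual (T.traj y) k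
      = ∑ i, (fun r : Fin N × Fin (nx i) => p r.1 ⟨i, r.2⟩) ⬝ᵥ
          ((T.subsystem i).stackC *ᵥ T.blk y i - (T.subsystem i).stackRhs)
        + ∑ k, p k ⬝ᵥ T.couplingRes y k := by
  simp only [dotProduct, Fintype.sum_prod_type, Fintype.sum_sigma, residual_traj, mul_add,
    Finset.sum_add_distrib, Pi.sub_apply, stackC_mulVec_sub]
  rw [Finset.sum_comm]

/-- A saddle point of the Lagrangian of the MPC problem yields a fixed point of ADMM. The
multiplier of the copy `ζ` is the derivative of the Lagrangian, the multiplier of the copy `ε`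
belongs to the coupling constraint. -/
theorem exists_fixedPoint (T : Decomposition P) (hP : P.IsConvex) {β : ℝ} {ρ : Fin M → ℝ}
    (hC : (T.consensus β ρ).Regular) (h : P.HasSaddlePoint) :
    ∃ y l, (T.consensus β ρ).Step (y ∘ (T.consensus β ρ).c) l y (y ∘ (T.consensus β ρ).c) l := by
  obtain ⟨z, hz, p, hp, hmin⟩ := h
  have hres := residual_eq_zero_of_forall_lagrangian_le hp
  obtain ⟨y, rfl, hyS, hyY, hyD, -, -⟩ :=
    T.exists_mem_splitFeasibleSet ((mem_feasibleSet_iff z).2 ⟨hres, hz⟩)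
  obtain ⟨η, hη⟩ := T.exists_coupling_multiplier p
  set pC : T.Idx → ℝ := fun j =>
    ((fun r : Fin N × Fin (nx j.1) => p r.1 ⟨j.1, r.2⟩) ᵥ* (T.subsystem j.1).stackC) j.2 with hpC
  set pD : T.Idx → ℝ := η ᵥ* T.couplingD with hpD
  have hpC_dot : ∀ v : T.Idx → ℝ, pC ⬝ᵥ v = ∑ i, (fun r : Fin N × Fin (nx i) => p r.1 ⟨i, r.2⟩) ⬝ᵥ
      (T.subsystem i).stackC *ᵥ T.blk v i := fun v => by
    rw [dotProduct, Fintype.sum_sigma]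
    exact Finset.sum_congr rfl fun i _ => by rw [Matrix.dotProduct_mulVec]; rfl
  have hpD_dot : ∀ v : T.Idx → ℝ, pD ⬝ᵥ v = η ⬝ᵥ T.couplingD *ᵥ v := fun v =>
    (Matrix.dotProduct_mulVec _ _ _).symm
  have hlag : ∃ c, ∀ v, P.lagrangian (T.traj v) p
      = quad T.splitH (T.splitLin + pC + pD) v + c := by
    refine ⟨∑ i, (T.subsystem i).stackConst
      - ∑ i, (fun r : Fin N × Fin (nx i) => p r.1 ⟨i, r.2⟩) ⬝ᵥ (T.subsystem i).stackRhs
      - η ⬝ᵥ T.couplingRhs, fun v => ?_⟩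
    have h1 : quad T.splitH (T.splitLin + pC + pD) v
        = quad T.splitH T.splitLin v + pC ⬝ᵥ v + pD ⬝ᵥ v := by
      simp only [quad, add_dotProduct]
      ring
    rw [lagrangian, ← T.sum_stackObj_add_stackConst hP, sum_dotProduct_residual_traj, hη, h1,
      quad_splitH, hpC_dot, hpD_dot]
    simp only [dotProduct_sub, Finset.sum_add_distrib, Finset.sum_sub_distrib]
    ring
  obtain ⟨c, hc⟩ := hlag
  -- stationarity of the Lagrangian on the constraint set
  have hstat : ∀ v : T.Idx → ℝ, (∀ i, T.blk v i ∈ (T.subsystem i).stackY) →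
      0 ≤ (T.splitH *ᵥ y + (T.splitLin + pC + pD)) ⬝ᵥ (v - y) := by
    refine ((hasQuadExpansion_quad (T.splitH_isSymm hP) (T.splitH_nonneg hP) _).isMinOn_iff
      (S := {v | ∀ i, T.blk v i ∈ (T.subsystem i).stackY}) ?_ hyY).1 (isMinOn_iff.2 ?_)
    · intro v hv w hw a b ha hb hab
      exact (T.forall_blk_mem_stackY_iff _).2 (convex_constraintSet hP
        ((T.forall_blk_mem_stackY_iff _).1 hv) ((T.forall_blk_mem_stackY_iff _).1 hw) ha hb hab)
    · intro v hv
      have := hmin _ ((T.forall_blk_mem_stackY_iff v).1 hv)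
      rw [hc, hc] at this
      linarith
  set μ : T.Idx → ℝ := T.splitH *ᵥ y + (T.splitLin + pC + pD) with hμ
  set l : T.Idx ⊕ T.Idx → ℝ := fun k => Sum.elim μ (-pD) k / (T.consensus β ρ).E k with hl
  have hldot : ∀ v : T.Idx ⊕ T.Idx → ℝ, wInner (T.consensus β ρ).E l v
      = μ ⬝ᵥ (v ∘ Sum.inl) - pD ⬝ᵥ (v ∘ Sum.inr) := fun v => by
    have h1 : wInner (T.consensus β ρ).E l v = ∑ k, Sum.elim μ (-pD) k * v k :=
      Finset.sum_congr rfl fun k _ => by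
        rw [hl, ← mul_assoc, mul_div_cancel₀ _ (hC.E_pos k).ne']
    rw [h1, Fintype.sum_sum_type]
    simp [dotProduct, sub_eq_add_neg]
  refine ⟨y, l, ConsensusProblem.step_of_kkt hC hyS ⟨hyY, hyD⟩ (fun v hv => ?_) fun v hv => ?_⟩
  · have h1 : pC ⬝ᵥ (v - y) = 0 := by
      rw [dotProduct_sub, hpC_dot, hpC_dot]
      simp only [hyS, hv _, sub_self]
    rw [hldot]
    refine le_of_eq ?_
    have h2 : (v - y) ∘ (T.consensus β ρ).c ∘ Sum.inl = v - y := rfl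
    have h3 : (v - y) ∘ (T.consensus β ρ).c ∘ Sum.inr = v - y := rfl
    have h4 : (T.consensus β ρ).H = T.splitH := rfl
    have h5 : (T.consensus β ρ).g = T.splitLin := rfl
    rw [Function.comp_assoc, Function.comp_assoc, h2, h3, h4, h5, hμ]
    simp only [add_dotProduct]
    linarith
  · rw [hldot]
    have h1 : pD ⬝ᵥ (v ∘ Sum.inr - y) = 0 := by
      rw [dotProduct_sub, hpD_dot, hpD_dot, hv.2, hyD, sub_self]
    have h2 : (v - y ∘ (T.consensus β ρ).c) ∘ Sum.inl = v ∘ Sum.inl - y := rfl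
    have h3 : (v - y ∘ (T.consensus β ρ).c) ∘ Sum.inr = v ∘ Sum.inr - y := rfl
    rw [h2, h3, h1, sub_zero]
    exact hstat _ hv.1

theorem isOptimal_traj (T : Decomposition P) (hP : P.IsConvex) {y : T.Idx → ℝ}
    (h : T.IsSplitOptimal (y, y, y)) : P.IsOptimal (T.traj y) := by
  refine ⟨T.traj_mem_feasibleSet h.1, isMinOn_iff.2 fun z hz => ?_⟩
  obtain ⟨v, rfl, hv⟩ := T.exists_mem_splitFeasibleSet hz
  have h1 := isMinOn_iff.1 h.2 _ hv
  simpa only [splitObjective, T.sum_stackObj_add_stackConst hP] using h1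

theorem isSplitOptimal_of_step (T : Decomposition P) {β : ℝ} {ρ : Fin M → ℝ}
    (hC : (T.consensus β ρ).Regular) {y : T.Idx → ℝ} {l : T.Idx ⊕ T.Idx → ℝ}
    (h : (T.consensus β ρ).Step (y ∘ (T.consensus β ρ).c) l y (y ∘ (T.consensus β ρ).c) l) :
    T.IsSplitOptimal (y, y, y) := by
  refine ⟨⟨h.y_mem, h.z_mem.1, h.z_mem.2, rfl, rfl⟩, isMinOn_iff.2 ?_⟩
  rintro ⟨v, ζ, ε⟩ ⟨h1, h2, h3, h4, h5⟩
  obtain rfl : v = ζ := h4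
  obtain rfl : v = ε := h5
  have h6 : quad T.splitH T.splitLin y ≤ quad T.splitH T.splitLin v := h.quad_le hC h1 ⟨h2, h3⟩
  simp only [splitObjective, Finset.sum_add_distrib, ← quad_splitH]
  linarith

end Decomposition

/-! ### The case of a single subsystem -/

theorem isMinOn_preimage_iff {α γ : Type} {f : γ → ℝ} {S : Set γ} {g : α → γ}
    (hg : Function.Surjective g) {a : α} :
    IsMinOn (fun v => f (g v)) (g ⁻¹' S) a ↔ IsMinOn f S (g a) := by
  simp only [isMinOn_iff]
  exact ⟨fun h w hw => by obtain ⟨v, rfl⟩ := hg w; exact h v hw, fun h v hv => h _ hv⟩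

theorem external_eq_zero {M : ℕ} [Subsingleton (Fin M)] {nx nu : Fin M → ℕ}
    (G : Matrix (Σ i, Fin (nx i)) (Σ i, Fin (nu i)) ℝ) : external G = 0 := by
  ext r c
  simp [external, Subsingleton.elim r.1 c.1]

namespace Decomposition

open MPCProblem

variable {N M : ℕ} {nx nu : Fin M → ℕ} {P : MPCProblem N (Σ i, Fin (nx i)) (Σ i, Fin (nu i))}

theorem nw_eq_zero [Subsingleton (Fin M)] (T : Decomposition P) (i : Fin M) : T.nw i = 0 := by
  have hne : ∀ j : {j : Fin M // j ≠ i}, False := fun j => j.2 (Subsingleton.elim _ _)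
  have h1 : Set.range (extBlockRow P.A P.B i).col = ∅ :=
    Set.range_eq_empty_iff.2 ⟨by rintro (c | c) <;> exact hne c.1⟩
  by_contra h
  -- a column of `W i` would be a nonzero element of the trivial range
  let b : Fin (T.nw i) := ⟨0, Nat.pos_of_ne_zero h⟩
  refine (T.W_indep i).ne_zero b ?_
  have h2 : (T.W i).col b ∈ Submodule.span ℝ (Set.range (T.W i).col) :=
    Submodule.subset_span ⟨b, rfl⟩
  rwa [T.W_span, h1, Submodule.span_empty, Submodule.mem_bot] at h2

theorem isEmpty_virt [Subsingleton (Fin M)] (T : Decomposition P) :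
    IsEmpty (Σ i, Fin (T.nw i)) :=
  ⟨fun b => (Nat.not_lt_zero b.2) (by simpa [T.nw_eq_zero b.1] using b.2.2)⟩

theorem isEmpty_rows [Subsingleton (Fin M)] (T : Decomposition P) : IsEmpty T.rows := by
  refine ⟨fun r => T.rows_indep.ne_zero r ?_⟩
  have := T.isEmpty_virt
  funext c
  rcases c with (c | c) | c
  · simp [Matrix.row, external_eq_zero]
  · simp [Matrix.row, external_eq_zero]
  · exact isEmptyElim c

theorem couplingRes_eq_zero [Subsingleton (Fin M)] (T : Decomposition P) (y : T.Idx → ℝ)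
    (k : Fin N) : T.couplingRes y k = 0 := by
  have := T.isEmpty_virt
  rw [couplingRes, external_eq_zero, external_eq_zero, Subsingleton.elim (T.virt y k) 0]
  simp

/-- The position in `y` of a coordinate of the stacked variable of the unpartitioned problem. -/
def unpartIdx (T : Decomposition P) :
    StackIdx N (Σ i, Fin (nx i)) (Σ i, Fin (nu i)) → T.Idx
  | (k, Sum.inl b) => ⟨b.1, (k, Sum.inl (Sum.inl b.2))⟩
  | (k, Sum.inr a) => ⟨a.1, (k, Sum.inr a.2)⟩

theorem unpart_eq_comp (T : Decomposition P) (y : T.Idx → ℝ) : T.unpart y = y ∘ T.unpartIdx := by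
  funext ⟨k, j⟩
  rcases j with b | a <;> rfl

theorem unpart_sub (T : Decomposition P) (y z : T.Idx → ℝ) :
    T.unpart (y - z) = T.unpart y - T.unpart z := by
  simp only [unpart_eq_comp]
  rfl

theorem unpartIdx_bijective [Subsingleton (Fin M)] (T : Decomposition P) :
    Function.Bijective T.unpartIdx := by
  constructor
  · rintro ⟨k, ⟨i, b⟩ | ⟨i, a⟩⟩ ⟨k', ⟨i', b'⟩ | ⟨i', a'⟩⟩ h
    all_goals
      simp only [unpartIdx, Sigma.mk.injEq] at h
      obtain ⟨rfl, h⟩ := h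
      simp_all
  · rintro ⟨i, k, (b | b) | a⟩
    · exact ⟨(k, Sum.inl ⟨i, b⟩), rfl⟩
    · exact (T.isEmpty_virt.false ⟨i, b⟩).elim
    · exact ⟨(k, Sum.inr ⟨i, a⟩), rfl⟩

theorem unpart_bijective [Subsingleton (Fin M)] (T : Decomposition P) :
    Function.Bijective T.unpart := by
  have : T.unpart = fun y => y ∘ T.unpartIdx := funext T.unpart_eq_comp
  rw [this]
  exact ⟨T.unpartIdx_bijective.surjective.injective_comp_right,
    T.unpartIdx_bijective.injective.surjective_comp_right⟩

theorem sqNorm_unpart [Subsingleton (Fin M)] (T : Decomposition P) (v : T.Idx → ℝ) :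
    sqNorm (T.unpart v) = ∑ j, v j ^ 2 := by
  rw [unpart_eq_comp, ← T.unpartIdx_bijective.sum_comp]
  exact Finset.sum_congr rfl fun j _ => (sq _).symm

theorem stackC_mulVec_unpart_iff [Subsingleton (Fin M)] (T : Decomposition P) (y : T.Idx → ℝ) :
    P.stackC *ᵥ T.unpart y = P.stackRhs ↔
      ∀ i, (T.subsystem i).stackC *ᵥ T.blk y i = (T.subsystem i).stackRhs := by
  rw [stackC_mulVec_eq_iff, forall_stackC_eq_iff]
  simp only [couplingRes_eq_zero, funext_iff, Sigma.forall]
  rfl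

theorem unpart_mem_stackY_iff (T : Decomposition P) (y : T.Idx → ℝ) :
    T.unpart y ∈ P.stackY ↔ ∀ i, T.blk y i ∈ (T.subsystem i).stackY := by
  rw [mem_stackY_iff, forall_blk_mem_stackY_iff]
  rfl

theorem isProj_unpart_iff [Subsingleton (Fin M)] (T : Decomposition P) (z p : T.Idx → ℝ) :
    IsProj P.stackY (T.unpart z) (T.unpart p) ↔
      ∀ i, IsProj (T.subsystem i).stackY (T.blk z i) (T.blk p i) := by
  rw [T.forall_isProj_iff (a := 1) (fun _ => one_pos), IsProj, unpart_mem_stackY_iff,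
    ← isMinOn_preimage_iff T.unpart_bijective.surjective]
  have h1 : ∀ v, sqNorm (T.unpart z - T.unpart v) = ∑ j, (1 : Fin M → ℝ) j.1 * (z j - v j) ^ 2 :=
    fun v => by
      rw [← unpart_sub, sqNorm_unpart]
      exact (Finset.sum_congr rfl fun j _ => (one_mul _).symm)
  have h2 : T.unpart ⁻¹' P.stackY = {v | ∀ i, T.blk v i ∈ (T.subsystem i).stackY} :=
    Set.ext T.unpart_mem_stackY_iff
  simp only [h1, h2]

theorem isMinOn_unpart_iff [Subsingleton (Fin M)] (T : Decomposition P) (hP : P.IsConvex)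
    {ρ : Fin M → ℝ} {ρ₀ : ℝ} (hρ : ∀ i, ρ i = ρ₀) (ζ ε lζ lε y : T.Idx → ℝ)
    (hy : ∀ i, (T.subsystem i).stackC *ᵥ T.blk y i = (T.subsystem i).stackRhs) :
    IsMinOn (fun v => P.stackObj v + ρ₀ / 2 * sqNorm (v - T.unpart ζ - T.unpart lζ))
        {v | P.stackC *ᵥ v = P.stackRhs} (T.unpart y) ↔
      ∀ i, IsMinOn (fun v => (T.subsystem i).stackObj v + ρ i / 2 *
        (1 * sqNorm (v - T.blk ζ i - T.blk lζ i)
          + (1 - 1) * sqNorm (v - T.blk ε i - T.blk lε i)))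
        {v | (T.subsystem i).stackC *ᵥ v = (T.subsystem i).stackRhs} (T.blk y i) := by
  have h1 := isMinOn_sum_iff (F := fun i v => (T.subsystem i).stackObj v + ρ i / 2 *
      (1 * sqNorm (v - T.blk ζ i - T.blk lζ i) + (1 - 1) * sqNorm (v - T.blk ε i - T.blk lε i)))
    (S := fun i => {v | (T.subsystem i).stackC *ᵥ v = (T.subsystem i).stackRhs}) (p := y) hy
  refine Iff.trans ?_ h1
  rw [← isMinOn_preimage_iff T.unpart_bijective.surjective,
    ← isMinOn_add_const_iff (P.stackConst - ∑ i, (T.subsystem i).stackConst)]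
  have h2 : T.unpart ⁻¹' {v | P.stackC *ᵥ v = P.stackRhs}
      = {v | ∀ i, (T.subsystem i).stackC *ᵥ T.blk v i = (T.subsystem i).stackRhs} :=
    Set.ext T.stackC_mulVec_unpart_iff
  have hobj : ∀ v, P.stackObj (T.unpart v) + P.stackConst
      = ∑ i, ((T.subsystem i).stackObj (T.blk v i) + (T.subsystem i).stackConst) := fun v => by
    rw [T.sum_stackObj_add_stackConst hP]
    exact stackObj_add_stackConst P hP.Q_psd.isHermitian hP.R_psd.isHermitian _
  have hsq : ∀ v, ρ₀ / 2 * sqNorm (T.unpart v - T.unpart ζ - T.unpart lζ)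
      = ∑ i, ρ i / 2 * sqNorm (T.blk v i - T.blk ζ i - T.blk lζ i) := fun v => by
    have h3 := T.sum_mul_sqNorm_blk (fun i => ρ i / 2) (v - ζ - lζ)
    rw [← unpart_sub, ← unpart_sub, sqNorm_unpart, Finset.mul_sum]
    simp only [hρ] at h3 ⊢
    exact h3.symm
  have h6 : ∀ v, P.stackObj (T.unpart v)
        + ρ₀ / 2 * sqNorm (T.unpart v - T.unpart ζ - T.unpart lζ)
        + (P.stackConst - ∑ i, (T.subsystem i).stackConst)
      = ∑ i, ((T.subsystem i).stackObj (T.blk v i) + ρ i / 2 *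
        (1 * sqNorm (T.blk v i - T.blk ζ i - T.blk lζ i)
          + (1 - 1) * sqNorm (T.blk v i - T.blk ε i - T.blk lε i))) := fun v => by
    have h7 := hobj v
    simp only [sub_self, zero_mul, add_zero, one_mul, Finset.sum_add_distrib] at h7 ⊢
    rw [hsq]
    linarith
  simp only [h2, h6]
  rfl

/-- Without virtual inputs and with `β = 1`, an iteration of structure-exploiting ADMM is an
iteration of conventional ADMM together with an arbitrary choice of `ε`, which has weight zero. -/
theorem step_iff_convStep [Subsingleton (Fin M)] (T : Decomposition P) (hP : P.IsConvex)
    {ρ : Fin M → ℝ} {ρ₀ : ℝ} (hρ : ∀ i, ρ i = ρ₀) (s s' : T.State) :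
    T.Step 1 ρ s s' ↔
      P.ConvStep ρ₀ s.toConv s'.toConv ∧ s'.lamε = s.lamε - (s'.y - s'.ε) := by
  have hinj := T.unpart_bijective.injective
  have hlam : T.unpart (s.lamζ - (s'.y - s'.ζ))
      = T.unpart s.lamζ - (T.unpart s'.y - T.unpart s'.ζ) := by rw [unpart_sub, unpart_sub]
  constructor
  · intro h
    exact ⟨⟨(T.stackC_mulVec_unpart_iff _).2 h.y_feas,
      (T.isMinOn_unpart_iff hP hρ s.ζ s.ε s.lamζ s.lamε s'.y h.y_feas).2 h.y_min,
      T.unpart_sub _ _ ▸ (T.isProj_unpart_iff (s'.y - s.lamζ) s'.ζ).2 h.ζ_proj,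
      (congrArg T.unpart h.lamζ_eq).trans hlam⟩, h.lamε_eq⟩
  · rintro ⟨h, hl⟩
    have hy := (T.stackC_mulVec_unpart_iff s'.y).1 h.y_feas
    have := T.isEmpty_rows
    exact ⟨hy, (T.isMinOn_unpart_iff hP hρ s.ζ s.ε s.lamζ s.lamε s'.y hy).1 h.y_min,
      (T.isProj_unpart_iff (s'.y - s.lamζ) s'.ζ).1 (T.unpart_sub _ _ ▸ h.ζ_proj),
      ⟨Subsingleton.elim _ _, isMinOn_iff.2 fun v _ => by simp⟩,
      hinj (h.lam_eq.trans hlam.symm), hl⟩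

end Decomposition

end SEADMM

theorem proposition1 {N M : ℕ} {nx nu : Fin M → ℕ}
    (P : SEADMM.MPCProblem N (Σ i, Fin (nx i)) (Σ i, Fin (nu i)))
    (hconv : P.IsConvex) (hfeas : P.feasibleSet.Nonempty)
    (hX : IsClosed P.X) (hU : IsClosed P.U)
    (T : SEADMM.Decomposition P) (β : ℝ) (ρ : Fin M → ℝ) :
    -- (i)
    (P.HasSaddlePoint → 0 < β → β < 1 → (∀ i, 0 < ρ i) →
      (∀ s : T.State, ∃! s' : T.State, T.Step β ρ s s') ∧
      ∀ s : ℕ → T.State, (∀ t, T.Step β ρ (s t) (s (t + 1))) →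
        ∃ s' : T.State,
          Tendsto (fun t => (s t).y) atTop (𝓝 s'.y) ∧
          Tendsto (fun t => (s t).ζ) atTop (𝓝 s'.ζ) ∧
          Tendsto (fun t => (s t).ε) atTop (𝓝 s'.ε) ∧
          Tendsto (fun t => (s t).lamζ) atTop (𝓝 s'.lamζ) ∧
          Tendsto (fun t => (s t).lamε) atTop (𝓝 s'.lamε) ∧
          T.Step β ρ s' s' ∧
          s'.y = s'.ζ ∧ s'.ζ = s'.ε ∧
          T.IsSplitOptimal (s'.y, s'.ζ, s'.ε) ∧
          P.IsOptimal (T.traj s'.y)) ∧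
    -- (ii)
    (M = 1 → β = 1 → ∀ ρ₀ : ℝ, (∀ i, ρ i = ρ₀) →
      Function.Bijective T.unpart ∧
      (∀ s s' : T.State, T.Step β ρ s s' → P.ConvStep ρ₀ s.toConv s'.toConv) ∧
      ∀ (s : T.State) (c' : SEADMM.MPCProblem.ConvState
          (SEADMM.MPCProblem.StackIdx N (Σ i, Fin (nx i)) (Σ i, Fin (nu i)))),
        P.ConvStep ρ₀ s.toConv c' → ∃ s' : T.State, T.Step β ρ s s' ∧ s'.toConv = c') := by
  refine ⟨fun hsad hβ hβ' hρ => ?_, fun hM hβ ρ₀ hρ => ?_⟩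
  · have hC := T.consensus_regular hconv hfeas hX hU hβ hβ' hρ
    refine ⟨T.existsUnique_step hβ hρ hC, fun s hs => ?_⟩
    obtain ⟨y₀, l₀, h₀⟩ := T.exists_fixedPoint hconv hC hsad
    obtain ⟨y, l, hstep, hy, hz, hl⟩ := SEADMM.ConsensusProblem.exists_tendsto hC h₀
      (y := fun t => (s t).y) (z := fun t => Sum.elim (s t).ζ (s t).ε)
      (l := fun t => Sum.elim (s t).lamζ (s t).lamε) fun t => (T.step_iff hβ hρ _ _).1 (hs t)
    rw [tendsto_pi_nhds] at hz hl
    have hopt := T.isSplitOptimal_of_step hC hstep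
    refine ⟨⟨y, y, y, l ∘ Sum.inl, l ∘ Sum.inr⟩, hy,
      tendsto_pi_nhds.2 fun j => hz (Sum.inl j), tendsto_pi_nhds.2 fun j => hz (Sum.inr j),
      tendsto_pi_nhds.2 fun j => hl (Sum.inl j), tendsto_pi_nhds.2 fun j => hl (Sum.inr j),
      (T.step_iff hβ hρ _ _).2 ?_, rfl, rfl, hopt, T.isOptimal_traj hconv hopt⟩
    have hyy : Sum.elim y y = y ∘ (T.consensus β ρ).c := (Sum.comp_elim y id id).symm
    simpa only [Sum.elim_comp_inl_inr, hyy] using hstep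
  · subst hM hβ
    refine ⟨T.unpart_bijective, fun s s' h => ((T.step_iff_convStep hconv hρ s s').1 h).1,
      fun s c' h => ?_⟩
    obtain ⟨y, hy⟩ := T.unpart_bijective.surjective c'.y
    obtain ⟨ζ, hζ⟩ := T.unpart_bijective.surjective c'.ζ
    obtain ⟨l, hl⟩ := T.unpart_bijective.surjective c'.lam
    have hc : SEADMM.Decomposition.State.toConv ⟨y, ζ, y, l, s.lamε⟩ = c' :=
      SEADMM.MPCProblem.ConvState.ext hy hζ hl
    refine ⟨⟨y, ζ, y, l, s.lamε⟩, (T.step_iff_convStep hconv hρ _ _).2 ⟨hc ▸ h, ?_⟩, hc⟩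
    simp
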